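/- Let $\mathcal{H}$ be a complex Hilbert space and $\mathcal{L}\subset\mathcal{H}$ a standard subspace, i.e. a closed real-linear subspace with $\mathcal{L}\cap \mathrm{i}\mathcal{L}=\{0\}$ and $\overline{\mathcal{L}+\mathrm{i}\mathcal{L}}=\mathcal{H}$. Let $s$ be the closure of the antilinear operator $h+\mathrm{i}k\mapsto h-\mathrm{i}k$ ($h,k\in\mathcal{L}$), let $\delta=s^*s$ be the modular operator (so that $s=j\delta^{1/2}$ is the polar decomposition of $s$), and let $(e_\lambda)$ be the spectral resolution of $\delta$. For $f\in\mathcal{L}$ and $\alpha\in[0,1)$ let $$\mathcal{S}_\alpha(f)=\int_0^\infty\frac{\lambda^{1-\alpha}-1}{\alpha-1}\,\mathrm{d}(f,e_\lambda f),$$ let $\mathcal{S}(f)=-\int_0^\infty\ln\lambda\,\mathrm{d}(f,e_\lambda f)$ be the entropy of the vector $f$, and let $\mathcal{S}_1(f)=\mathcal{S}(f)$, which corresponds to the pointwise limit $\alpha\to1$ of the integrand. Then, for every $f\in\mathcal{L}$: 1. $\mathcal{S}_\alpha(f)$ is well defined for all $\alpha\in[0,1]$: the spectral resolution of $\delta$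 exists, the measure $\mathrm{d}(f,e_\lambda f)$ is concentrated on $(0,\infty)$, the integral converges absolutely (so $\mathcal{S}_\alpha(f)$ is finite) for $\alpha\in[0,1)$, and for $\alpha=1$ the negative part of $-\ln\lambda$ is integrable, so that $\mathcal{S}_1(f)\in(-\infty,+\infty]$. 2. As a function with values in $(-\infty,+\infty]$, $\alpha\mapsto\mathcal{S}_\alpha(f)$ is continuous on $[0,1]$. It is differentiable at every $\alpha\in(0,1)$, and also (from the right) at $\alpha=0$ if $\mathcal{S}(f)<\infty$. 3. $\mathcal{S}_0(f)=0$, and $\alpha\mapsto\mathcal{S}_\alpha(f)$ is monotonically increasing on $[0,1]$; hence $\mathcal{S}_\alpha(f)\ge0$ for all $\alpha\in[0,1]$. 4. $\lim_{\alpha\to1^-}\mathcal{S}_\alpha(f)=\mathcal{S}(f)$ (which may be $+\infty$), and $\mathcal{S}_\alpha(f)\le\mathcal{S}(f)$ for all $\alpha\in[0,1]$. -/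

import Mathlib

/-! ### Modular operator of a standard subspace -/

section Modular

open Complex Topology
open scoped ComplexInnerProductSpace ClosedSubmodule LinearPMap

variable {H : Type*} [NormedAddCommGroup H] [InnerProductSpace ℂ H]

namespace StandardSubspace

/-- The graph `{(h + i k, h - i k) | h, k ∈ L}` of the conjugation on `L + i L`. -/
def conjGraph (L : StandardSubspace H) : Submodule ℝ (H × H) where
  carrier := {p | ∃ h ∈ L.toClosedSubmodule, ∃ k ∈ L.toClosedSubmodule,
    p = (h + I • k, h - I • k)}
  zero_mem' := ⟨0, zero_mem _, 0, zero_mem _, by simp; rfl⟩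
  add_mem' := by
    rintro _ _ ⟨h, hh, k, hk, rfl⟩ ⟨h', hh', k', hk', rfl⟩
    refine ⟨h + h', add_mem hh hh', k + k', add_mem hk hk', ?_⟩
    ext <;> simp only [Prod.fst_add, Prod.snd_add, smul_add] <;> abel
  smul_mem' := by
    rintro c _ ⟨h, hh, k, hk, rfl⟩
    refine ⟨c • h, L.toClosedSubmodule.toSubmodule.smul_mem c hh, c • k,
      L.toClosedSubmodule.toSubmodule.smul_mem c hk, ?_⟩
    ext <;> simp [smul_add, smul_sub, smul_comm c I k]

/-- The densely defined operator `h + i k ↦ h - i k` (`h, k ∈ L`), as a real-linear operator: its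
graph is `L.conjGraph` by `graph_conjOp`. -/
noncomputable def conjOp (L : StandardSubspace H) : H →ₗ.[ℝ] H := L.conjGraph.toLinearPMap

/-- The Tomita operator `s`: the closure of `h + i k ↦ h - i k`. -/
noncomputable def tomita (L : StandardSubspace H) : H →ₗ.[ℝ] H := L.conjOp.closure

lemma conjGraph_single (L : StandardSubspace H) (p : H × H) (hp : p ∈ L.conjGraph)
    (h0 : p.1 = 0) : p.2 = 0 := by
  obtain ⟨h, hh, k, hk, rfl⟩ := hp
  have e : h = -(I • k) := eq_neg_of_add_eq_zero_left h0
  have hm : h ∈ L.toClosedSubmodule ⊓ L.toClosedSubmodule.mulI := by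
    refine ⟨hh, ?_⟩
    change h ∈ L.toClosedSubmodule.mulI
    rw [ClosedSubmodule.mem_mapEquiv_iff, scalarSMulCLE_symm_apply]
    have : (UnitI⁻¹ : ℂˣ) • h = -k := by
      rw [e, Units.smul_def]
      simp [smul_smul]
    rw [this]
    exact L.toClosedSubmodule.toSubmodule.neg_mem hk
  rw [L.IsSeparating] at hm
  have h1 : h = 0 := hm
  have h2 : I • k = 0 := by simpa [h1] using h0
  simp [h1, h2]

lemma graph_conjOp (L : StandardSubspace H) : L.conjOp.graph = L.conjGraph :=
  Submodule.toLinearPMap_graph_eq _ L.conjGraph_single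

lemma mem_conjGraph_iff (L : StandardSubspace H) (p : H × H) :
    p ∈ L.conjGraph ↔ p.1 + p.2 ∈ L.toClosedSubmodule ∧ I • (p.1 - p.2) ∈ L.toClosedSubmodule := by
  constructor
  · rintro ⟨h, hh, k, hk, rfl⟩
    constructor
    · have : h + I • k + (h - I • k) = (2 : ℝ) • h := by rw [two_smul]; abel
      change _ + _ ∈ _
      rw [this]
      exact L.toClosedSubmodule.toSubmodule.smul_mem 2 hh
    · have : I • (h + I • k - (h - I • k)) = (-2 : ℝ) • k := by
        have : h + I • k - (h - I • k) = I • k + I • k := by abel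
        rw [this, smul_add, smul_smul, I_mul_I, neg_smul, neg_smul, two_smul, one_smul]; abel
      change I • (_ - _) ∈ _
      rw [this]
      exact L.toClosedSubmodule.toSubmodule.smul_mem (-2) hk
  · rintro ⟨h1, h2⟩
    refine ⟨(1 / 2 : ℝ) • (p.1 + p.2), L.toClosedSubmodule.toSubmodule.smul_mem _ h1,
      (-1 / 2 : ℝ) • (I • (p.1 - p.2)), L.toClosedSubmodule.toSubmodule.smul_mem _ h2, ?_⟩
    have hI : I • ((-1 / 2 : ℝ) • (I • (p.1 - p.2))) = (1 / 2 : ℝ) • (p.1 - p.2) := by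
      rw [smul_comm I, smul_smul, I_mul_I, neg_smul, one_smul, smul_neg, ← neg_smul]
      norm_num
    rw [hI]
    ext <;> simp only <;> module

lemma isClosed_conjOp (L : StandardSubspace H) : L.conjOp.IsClosed := by
  have : (L.conjGraph : Set (H × H)) =
      (fun p : H × H => p.1 + p.2) ⁻¹' (L.toClosedSubmodule : Set H) ∩
      (fun p : H × H => I • (p.1 - p.2)) ⁻¹' (L.toClosedSubmodule : Set H) := by
    ext p
    exact L.mem_conjGraph_iff p
  rw [LinearPMap.IsClosed, graph_conjOp, this]
  have hc : IsClosed (L.toClosedSubmodule : Set H) := L.toClosedSubmodule.isClosed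
  exact (hc.preimage (by fun_prop)).inter (hc.preimage (by fun_prop))

lemma graph_tomita (L : StandardSubspace H) : L.tomita.graph = L.conjGraph := by
  rw [tomita, ← L.isClosed_conjOp.isClosable.graph_closure_eq_closure_graph,
    L.isClosed_conjOp.submodule_topologicalClosure_eq, graph_conjOp]

/-- `s` is antilinear, first half: it anticommutes with the complex structure. -/
lemma tomita_I_smul (L : StandardSubspace H) (x : L.tomita.domain) :
    ∃ hx : I • (x : H) ∈ L.tomita.domain, L.tomita ⟨I • (x : H), hx⟩ = -(I • L.tomita x) := by
  have hx := L.tomita.mem_graph x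
  rw [graph_tomita, mem_conjGraph_iff] at hx
  have : (I • (x : H), -(I • L.tomita x)) ∈ L.tomita.graph := by
    rw [graph_tomita, mem_conjGraph_iff]
    refine ⟨?_, ?_⟩
    · simpa [smul_sub, sub_eq_add_neg] using hx.2
    · have : I • (I • (x : H) - -(I • L.tomita x)) = -((x : H) + L.tomita x) := by
        rw [sub_neg_eq_add, ← smul_add, smul_smul, I_mul_I, neg_smul, one_smul]
      change I • (I • (x : H) - -(I • L.tomita x)) ∈ _
      rw [this]
      exact L.toClosedSubmodule.toSubmodule.neg_mem hx.1
  obtain ⟨y, hy1, hy2⟩ := (LinearPMap.mem_graph_iff _).1 this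
  have hy1 : (y : H) = I • (x : H) := hy1
  refine ⟨hy1 ▸ y.2, ?_⟩
  refine Eq.trans ?_ hy2
  congr 1
  exact Subtype.ext hy1.symm

lemma dense_tomita_domain (L : StandardSubspace H) : Dense (L.tomita.domain : Set H) := by
  have hs : ((L.toClosedSubmodule.toSubmodule ⊔ L.toClosedSubmodule.mulI.toSubmodule :
      Submodule ℝ H) : Set H) ⊆ L.tomita.domain := by
    intro x hx
    obtain ⟨h, hh, k', hk', rfl⟩ := Submodule.mem_sup.1 hx
    have hk : (UnitI⁻¹ : ℂˣ) • k' ∈ L.toClosedSubmodule := by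
      have := (ClosedSubmodule.mem_mapEquiv_iff (scalarSMulCLE H UnitI) _ _).1
        (show k' ∈ L.toClosedSubmodule.mulI from hk')
      rwa [scalarSMulCLE_symm_apply] at this
    have e : I • ((UnitI⁻¹ : ℂˣ) • k') = k' := smul_inv_smul UnitI k'
    have : (h + k', h - k') ∈ L.tomita.graph := by
      rw [graph_tomita]
      exact ⟨h, hh, _, hk, by rw [e]⟩
    exact LinearPMap.mem_domain_of_mem_graph this
  refine Dense.mono hs fun x => ?_
  have : x ∈ L.toClosedSubmodule ⊔ L.toClosedSubmodule.mulI := by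
    rw [L.IsCyclic]; trivial
  exact ClosedSubmodule.mem_sup.1 this

variable [CompleteSpace H]

/-- `s*` is antilinear as well. -/
lemma tomita_adjoint_I_smul (L : StandardSubspace H) (y : L.tomita†.domain) :
    ∃ hy : I • (y : H) ∈ L.tomita†.domain, L.tomita† ⟨I • (y : H), hy⟩ = -(I • L.tomita† y) := by
  have key : ∀ x : L.tomita.domain,
      inner ℝ (-(I • L.tomita† y)) (x : H) = inner ℝ (I • (y : H)) (L.tomita x) := by
    intro x
    obtain ⟨hx, e⟩ := L.tomita_I_smul x
    have h := LinearPMap.adjoint_isFormalAdjoint L.dense_tomita_domain y ⟨_, hx⟩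
    rw [e] at h
    simp only [ClosedSubmodule.inner_real_eq_re_inner, inner_neg_left, inner_neg_right,
      inner_smul_left, inner_smul_right] at h ⊢
    simp at h ⊢
    linarith
  have hy := LinearPMap.mem_adjoint_domain_of_exists (T := L.tomita) (I • (y : H)) ⟨_, key⟩
  exact ⟨hy, LinearPMap.adjoint_apply_eq L.dense_tomita_domain ⟨_, hy⟩ key⟩

/-- The domain of `s* s` is a complex subspace, on which `s* s` is complex homogeneous. -/
lemma modular_smul_aux (L : StandardSubspace H) (x : L.tomita.domain)
    (hx : L.tomita x ∈ L.tomita†.domain) (c : ℂ) :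
    ∃ hcx : c • (x : H) ∈ L.tomita.domain, ∃ hsx : L.tomita ⟨_, hcx⟩ ∈ L.tomita†.domain,
      L.tomita† ⟨_, hsx⟩ = c • L.tomita† ⟨_, hx⟩ := by
  obtain ⟨hI, eI⟩ := L.tomita_I_smul x
  obtain ⟨hJ, eJ⟩ := L.tomita_adjoint_I_smul ⟨_, hx⟩
  have hc : ∀ z : H, c • z = c.re • z + c.im • (I • z) := by
    intro z
    conv_lhs => rw [← Complex.re_add_im c]
    rw [add_smul, mul_smul]
    rfl
  let u : L.tomita.domain := c.re • x + c.im • ⟨I • (x : H), hI⟩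
  have hu : (u : H) = c • (x : H) := (hc x).symm
  have hcx : c • (x : H) ∈ L.tomita.domain := hu ▸ u.2
  have e1 : L.tomita ⟨_, hcx⟩ = c.re • L.tomita x + c.im • -(I • L.tomita x) := by
    have : (⟨_, hcx⟩ : L.tomita.domain) = u := Subtype.ext hu.symm
    rw [this, LinearPMap.map_add, LinearPMap.map_smul, LinearPMap.map_smul, eI]
  let v : L.tomita†.domain := c.re • ⟨_, hx⟩ + c.im • -⟨_, hJ⟩
  have hv : (v : H) = L.tomita ⟨_, hcx⟩ := e1.symm
  have hsx : L.tomita ⟨_, hcx⟩ ∈ L.tomita†.domain := hv ▸ v.2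
  refine ⟨hcx, hsx, ?_⟩
  have : (⟨_, hsx⟩ : L.tomita†.domain) = v := Subtype.ext hv.symm
  rw [this, LinearPMap.map_add, LinearPMap.map_smul, LinearPMap.map_smul, LinearPMap.map_neg, eJ,
    neg_neg, hc]

/-- The modular operator `δ = s* s` (so that `s = j δ^{1/2}` is the polar decomposition of `s`),
with its natural domain `{x ∈ dom s | s x ∈ dom s*}`. It is complex linear, as a product of two
antilinear operators. The adjoint of the antilinear operator `s` is its adjoint with respect to the
real part of the scalar product. -/
noncomputable def modularOperator (L : StandardSubspace H) : H →ₗ.[ℂ] H where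
  domain :=
    { carrier := {x | ∃ hx : x ∈ L.tomita.domain, L.tomita ⟨x, hx⟩ ∈ L.tomita†.domain}
      zero_mem' := ⟨zero_mem _, by
        have : L.tomita ⟨0, zero_mem _⟩ = 0 := L.tomita.map_zero
        rw [this]; exact zero_mem _⟩
      add_mem' := by
        rintro x y ⟨hx, hx'⟩ ⟨hy, hy'⟩
        refine ⟨add_mem hx hy, ?_⟩
        have : L.tomita ⟨x + y, add_mem hx hy⟩ = L.tomita ⟨x, hx⟩ + L.tomita ⟨y, hy⟩ :=
          L.tomita.map_add ⟨x, hx⟩ ⟨y, hy⟩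
        rw [this]; exact add_mem hx' hy'
      smul_mem' := by
        rintro c x ⟨hx, hx'⟩
        obtain ⟨h1, h2, -⟩ := L.modular_smul_aux ⟨x, hx⟩ hx' c
        exact ⟨h1, h2⟩ }
  toFun :=
    { toFun := fun x => L.tomita† ⟨L.tomita ⟨x, x.2.1⟩, x.2.2⟩
      map_add' := by
        rintro ⟨x, hx, hx'⟩ ⟨y, hy, hy'⟩
        rw [← LinearPMap.map_add]
        congr 1
        exact Subtype.ext (L.tomita.map_add ⟨x, hx⟩ ⟨y, hy⟩)
      map_smul' := by
        rintro c ⟨x, hx, hx'⟩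
        obtain ⟨h1, h2, h3⟩ := L.modular_smul_aux ⟨x, hx⟩ hx' c
        exact h3 }

end StandardSubspace

end Modular

/-! ### Spectral resolutions -/

section Spectral

open MeasureTheory Filter Topology Set
open scoped ComplexInnerProductSpace

/-- A resolution of the identity on a Hilbert space: an increasing, strongly right-continuous
family `e t` (`t ∈ ℝ`) of orthogonal projections that tends strongly to `0` for `t → -∞` and
to the identity for `t → ∞`. -/
structure ResolutionOfIdentity (H : Type*) [NormedAddCommGroup H] [InnerProductSpace ℂ H]
    [CompleteSpace H] where
  /-- The projections. -/
  proj : ℝ → H →L[ℂ] H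
  isStarProjection : ∀ t, IsStarProjection (proj t)
  monotone : ∀ s t, s ≤ t → proj s * proj t = proj s
  rightContinuous : ∀ x t, ContinuousWithinAt (fun s => proj s x) (Ici t) t
  tendsto_atBot : ∀ x, Tendsto (fun t => proj t x) atBot (𝓝 0)
  tendsto_atTop : ∀ x, Tendsto (fun t => proj t x) atTop (𝓝 x)

variable {H : Type*} [NormedAddCommGroup H] [InnerProductSpace ℂ H] [CompleteSpace H]

namespace ResolutionOfIdentity

lemma inner_proj (e : ResolutionOfIdentity H) (x : H) (t : ℝ) :
    (⟪x, e.proj t x⟫).re = ‖e.proj t x‖ ^ 2 := by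
  have h1 : e.proj t (e.proj t x) = e.proj t x :=
    congrArg (fun T : H →L[ℂ] H => T x) (e.isStarProjection t).isIdempotentElem
  have h2 := (ContinuousLinearMap.isSelfAdjoint_iff_isSymmetric.1
    (e.isStarProjection t).isSelfAdjoint) x (e.proj t x)
  have h3 : ⟪e.proj t x, e.proj t x⟫ = ⟪x, e.proj t x⟫ := by
    simpa [h1] using h2
  rw [← h3, inner_self_eq_norm_sq_to_K]
  norm_cast

/-- The right-continuous increasing function `t ↦ (x, e_t x)`. -/
noncomputable def distribution (e : ResolutionOfIdentity H) (x : H) : StieltjesFunction ℝ where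
  toFun t := (⟪x, e.proj t x⟫).re
  mono' s t hst := by
    simp only [inner_proj]
    have h1 : e.proj s (e.proj t x) = e.proj s x :=
      congrArg (fun T : H →L[ℂ] H => T x) (e.monotone s t hst)
    have h2 : ‖e.proj s x‖ ≤ ‖e.proj t x‖ := by
      have h3 := e.inner_proj (e.proj t x) s
      rw [h1] at h3
      have h4 : ‖e.proj s x‖ ^ 2 ≤ ‖e.proj t x‖ * ‖e.proj s x‖ := by
        rw [← h3]
        exact re_inner_le_norm (𝕜 := ℂ) _ _
      nlinarith [norm_nonneg (e.proj s x), norm_nonneg (e.proj t x)]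
    gcongr
  right_continuous' t :=
    (Complex.continuous_re.comp (continuous_const.inner continuous_id)).continuousAt
      |>.comp_continuousWithinAt (e.rightContinuous x t)

/-- The spectral measure `d(x, e_t x)`. -/
noncomputable def spectralMeasure (e : ResolutionOfIdentity H) (x : H) : Measure ℝ :=
  (e.distribution x).measure

/-- `e` is the spectral resolution of the operator `A`, i.e. `A = ∫ t de_t`: the domain of `A`
consists of all `x` with `∫ t² d(x, e_t x) < ∞`, and `(x, A x) = ∫ t d(x, e_t x)` for these `x`
(which determines `A x` by polarization). -/
def IsResolutionOf (e : ResolutionOfIdentity H) (A : H →ₗ.[ℂ] H) : Prop :=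
  (∀ x : H, x ∈ A.domain ↔ Integrable (fun t : ℝ => t ^ 2) (e.spectralMeasure x)) ∧
    ∀ x : A.domain, ⟪(x : H), A x⟫ = ((∫ t, t ∂(e.spectralMeasure (x : H)) : ℝ) : ℂ)

/-- The spectral resolution of the identity operator: `e_t = 0` for `t < 1` and `e_t = 1` for
`t ≥ 1`. -/
noncomputable instance : Inhabited (ResolutionOfIdentity H) where
  default :=
    { proj := fun t => if 1 ≤ t then 1 else 0
      isStarProjection := fun t => by
        split_ifs
        exacts [.one _, .zero _]
      monotone := fun s t hst => by
        by_cases h : 1 ≤ s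
        · simp [h, h.trans hst]
        · simp [h]
      rightContinuous := fun x t => by
        by_cases h : 1 ≤ t
        · refine (continuousWithinAt_const (b := x)).congr (fun s hs => ?_) ?_
          · rw [if_pos (h.trans hs)]; rfl
          · rw [if_pos h]; rfl
        · refine ((continuousAt_const (y := (0 : H))).congr ?_).continuousWithinAt
          filter_upwards [Iio_mem_nhds (not_le.1 h)] with s hs
          rw [if_neg (not_le.2 (mem_Iio.1 hs))]; rfl
      tendsto_atBot := fun x => by
        refine tendsto_const_nhds.congr' ?_
        filter_upwards [Iio_mem_atBot (1 : ℝ)] with s hs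
        rw [if_neg (not_le.2 (mem_Iio.1 hs))]; rfl
      tendsto_atTop := fun x => by
        refine tendsto_const_nhds.congr' ?_
        filter_upwards [Ici_mem_atTop (1 : ℝ)] with s hs
        rw [if_pos (mem_Ici.1 hs)]; rfl }

end ResolutionOfIdentity

/-- The spectral integral of a real function with respect to a measure, as an extended real number:
the integral of the positive part minus the integral of the negative part. -/
noncomputable def extIntegral (μ : Measure ℝ) (g : ℝ → ℝ) : EReal :=
  ((∫⁻ t, ENNReal.ofReal (g t) ∂μ : ENNReal) : EReal) -
    ((∫⁻ t, ENNReal.ofReal (-g t) ∂μ : ENNReal) : EReal)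

namespace StandardSubspace

/-- The spectral resolution `e` of the modular operator `δ`. -/
noncomputable def modularResolution (L : StandardSubspace H) : ResolutionOfIdentity H :=
  Classical.epsilon fun e => e.IsResolutionOf L.modularOperator

/-- The measure `d(f, e_t f)`. -/
noncomputable def spectralMeasure (L : StandardSubspace H) (f : H) : Measure ℝ :=
  L.modularResolution.spectralMeasure f

/-- The entropy `-∫_0^∞ ln t d(f, e_t f)` of a vector. -/
noncomputable def entropy (L : StandardSubspace H) (f : H) : EReal :=
  extIntegral ((L.spectralMeasure f).restrict (Ioi 0)) fun t => -Real.log t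

/-- The function `(t ^ (1 - α) - 1) / (α - 1)`, extended continuously to `α = 1`. -/
noncomputable def renyiIntegrand (α t : ℝ) : ℝ :=
  if α = 1 then -Real.log t else (t ^ (1 - α) - 1) / (α - 1)

/-- The Rényi entropy `∫_0^∞ (t ^ (1 - α) - 1) / (α - 1) d(f, e_t f)` of a vector. -/
noncomputable def renyiEntropy (L : StandardSubspace H) (α : ℝ) (f : H) : EReal :=
  extIntegral ((L.spectralMeasure f).restrict (Ioi 0)) (renyiIntegrand α)

end StandardSubspace

end Spectral

/-! ### The modular operator and its resolvent -/

section Modular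

open Complex Topology
open scoped ComplexInnerProductSpace ClosedSubmodule LinearPMap

variable {H : Type*} [NormedAddCommGroup H] [InnerProductSpace ℂ H]

namespace StandardSubspace

/-! Everything follows from one symmetry: for `f ∈ L` the measure `m = d(f, e_t f)` satisfies `t
dm(t) = dm(1/t)` on `(0, ∞)` (`isInversionSymmetric_spectralMeasure`). In particular `∫ t dm =
m(ℝ)`, so the integrand at `α = 0`, which is `1 - t`, has integral zero. Subtracting it does not
change `S_α`, and since the integrand increases pointwise in `α`, what remains is non-negative
(`extIntegral_eq`). Positivity and monotonicity are then immediate. Continuity is dominated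
convergence below `1` and monotone convergence at `1`, where the value may be infinite. On `(0, 1)`
differentiability is that of the moment generating function of `log`. The symmetry also gives `S_α /
α = S_{1-α} / (1 - α)`, so the difference quotient at `0` tends to `S_1`.

The symmetry itself comes from `s f = f` and `s δ = δ⁻¹ s`. With `B = (1 + δ)⁻¹` the latter takes
the bounded form `s B = (1 - B) s` (`resolvent_mem_conjGraph`). Applied to polynomials in `B`, it
shows that `(1 - u) dν(u)` is invariant under `u ↦ 1 - u`, where `ν` is the spectral measure of `B`
at `f`; the substitution `t = u⁻¹ - 1` turns this into the symmetry of `m`.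

As `modularResolution` is chosen by `IsResolutionOf` alone, both existence and uniqueness of the
resolution are needed to identify `m` with the image of `ν`. The measures `ν` come from the
Riesz–Markov theorem and the continuous functional calculus, and the projections from kernels of
functions of `B`. -/

lemma mem_graph_tomita_iff (L : StandardSubspace H) (x y : H) :
    (x, y) ∈ L.conjGraph ↔ ∃ hx : x ∈ L.tomita.domain, L.tomita ⟨x, hx⟩ = y := by
  rw [← graph_tomita, LinearPMap.mem_graph_iff]
  constructor
  · rintro ⟨⟨a, ha⟩, h1, h2⟩
    obtain rfl : a = x := h1
    exact ⟨ha, h2⟩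
  · rintro ⟨hx, h⟩
    exact ⟨⟨x, hx⟩, rfl, h⟩

/-- This is `s = s⁻¹`, the source of the exchange of `δ` and `δ⁻¹` below. -/
lemma conjGraph_swap (L : StandardSubspace H) {x y : H} (h : (x, y) ∈ L.conjGraph) :
    (y, x) ∈ L.conjGraph := by
  rw [mem_conjGraph_iff] at h ⊢
  refine ⟨by simpa [add_comm] using h.1, ?_⟩
  have := L.toClosedSubmodule.toSubmodule.neg_mem h.2
  rw [← smul_neg] at this
  simpa using this

lemma mem_conjGraph_self (L : StandardSubspace H) {f : H} (hf : f ∈ L.toClosedSubmodule) :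
    (f, f) ∈ L.conjGraph :=
  ⟨f, hf, 0, zero_mem _, by simp⟩

lemma isClosed_conjGraph (L : StandardSubspace H) : IsClosed (L.conjGraph : Set (H × H)) := by
  have := L.isClosed_conjOp
  rwa [LinearPMap.IsClosed, graph_conjOp] at this

lemma dense_conjGraph_fst (L : StandardSubspace H) {z : H}
    (h : ∀ p ∈ L.conjGraph, (⟪z, p.1⟫).re = 0) : z = 0 := by
  refine L.dense_tomita_domain.eq_zero_of_inner_left ℝ fun v hv => ?_
  exact h (v, L.tomita ⟨v, hv⟩) ((L.mem_graph_tomita_iff _ _).2 ⟨hv, rfl⟩)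

/-- `(y, z)` belongs to the graph of the adjoint of the Tomita operator. -/
def AdjointRel (L : StandardSubspace H) (y z : H) : Prop :=
  ∀ p ∈ L.conjGraph, (⟪z, p.1⟫).re = (⟪y, p.2⟫).re

/-- The adjoint `s*` inherits from `s` that it is its own inverse. -/
lemma AdjointRel.swap {L : StandardSubspace H} {y z : H} (h : L.AdjointRel y z) :
    L.AdjointRel z y := by
  rintro ⟨v, w⟩ hp
  exact (h _ (L.conjGraph_swap hp)).symm

variable [CompleteSpace H]

lemma adjointRel_iff (L : StandardSubspace H) (y z : H) :
    L.AdjointRel y z ↔ ∃ hy : y ∈ L.tomita†.domain, L.tomita† ⟨y, hy⟩ = z := by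
  constructor
  · intro h
    have key : ∀ x : L.tomita.domain, inner ℝ z (x : H) = inner ℝ y (L.tomita x) := fun x =>
      h (x, L.tomita x) ((L.mem_graph_tomita_iff _ _).2 ⟨x.2, rfl⟩)
    have hy := LinearPMap.mem_adjoint_domain_of_exists (T := L.tomita) y ⟨_, key⟩
    exact ⟨hy, LinearPMap.adjoint_apply_eq L.dense_tomita_domain ⟨_, hy⟩ key⟩
  · rintro ⟨hy, rfl⟩ ⟨v, w⟩ hp
    obtain ⟨hv, rfl⟩ := (L.mem_graph_tomita_iff _ _).1 hp
    exact LinearPMap.adjoint_isFormalAdjoint L.dense_tomita_domain ⟨y, hy⟩ ⟨v, hv⟩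

lemma mem_graph_modularOperator_iff (L : StandardSubspace H) (x z : H) :
    (x, z) ∈ L.modularOperator.graph ↔ ∃ y, (x, y) ∈ L.conjGraph ∧ L.AdjointRel y z := by
  rw [LinearPMap.mem_graph_iff]
  constructor
  · rintro ⟨⟨a, ha⟩, h1, h2⟩
    obtain rfl : a = x := h1
    exact ⟨L.tomita ⟨a, ha.1⟩, (L.mem_graph_tomita_iff _ _).2 ⟨ha.1, rfl⟩,
      (L.adjointRel_iff _ _).2 ⟨ha.2, h2⟩⟩
  · rintro ⟨y, h1, h2⟩
    obtain ⟨hx, rfl⟩ := (L.mem_graph_tomita_iff _ _).1 h1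
    obtain ⟨hy, rfl⟩ := (L.adjointRel_iff _ _).1 h2
    exact ⟨⟨x, hx, hy⟩, rfl, rfl⟩

/-- The modular operator is symmetric. -/
lemma inner_modularOperator (L : StandardSubspace H) {x z x' z' : H}
    (h : (x, z) ∈ L.modularOperator.graph) (h' : (x', z') ∈ L.modularOperator.graph) :
    ⟪z, x'⟫ = ⟪x, z'⟫ := by
  have key : ∀ {x z x' z' : H}, (x, z) ∈ L.modularOperator.graph →
      (x', z') ∈ L.modularOperator.graph → (⟪z, x'⟫).re = (⟪x, z'⟫).re := by
    intro x z x' z' h h'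
    obtain ⟨y, h1, h2⟩ := (L.mem_graph_modularOperator_iff _ _).1 h
    obtain ⟨y', h1', h2'⟩ := (L.mem_graph_modularOperator_iff _ _).1 h'
    rw [h2 _ h1', ← inner_conj_symm x z', conj_re, h2' _ h1, ← inner_conj_symm y' y, conj_re]
  -- The adjoint is a real one, so `key` only sees real parts. As `δ` is complex linear, multiplying
  -- the second pair by `I` yields the imaginary parts.
  apply Complex.ext (key h h')
  have := key h (L.modularOperator.graph.smul_mem I h')
  simpa [inner_smul_right] using this

lemma re_inner_nonneg_modularOperator (L : StandardSubspace H) {x z : H}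
    (h : (x, z) ∈ L.modularOperator.graph) : 0 ≤ (⟪z, x⟫).re := by
  obtain ⟨y, h1, h2⟩ := (L.mem_graph_modularOperator_iff _ _).1 h
  rw [h2 _ h1]
  exact inner_self_nonneg (𝕜 := ℂ)

/-- If `δ x = 0`, then `‖s x‖² = (δ x, x) = 0`, and `s` is injective, being its own inverse. -/
lemma modularOperator_injective (L : StandardSubspace H) {x : H}
    (h : (x, 0) ∈ L.modularOperator.graph) : x = 0 := by
  obtain ⟨y, h1, h2⟩ := (L.mem_graph_modularOperator_iff _ _).1 h
  have h3 := h2 _ h1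
  have : y = 0 := by
    have h4 : (⟪y, y⟫).re = ‖y‖ ^ 2 := inner_self_eq_norm_sq (𝕜 := ℂ) y
    rw [← h3, inner_zero_left, zero_re] at h4
    exact norm_eq_zero.1 (pow_eq_zero_iff two_ne_zero |>.1 h4.symm)
  subst this
  exact L.conjGraph_single _ (L.conjGraph_swap h1) rfl

/-- `1 + δ` is surjective. -/
lemma exists_add_modularOperator_eq (L : StandardSubspace H) (z : H) :
    ∃ x, (x, z - x) ∈ L.modularOperator.graph := by
  -- Von Neumann's argument: let `(x, y)` be the projection of `(z, 0)` onto the closed graph of `s`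
  -- in the Hilbert sum `H ⊕ H`. Orthogonality of `(z - x, -y)` to the graph says `s* y = z - x`,
  -- that is `δ x = z - x`.
  let K : Submodule ℝ (WithLp 2 (H × H)) :=
    L.conjGraph.map (WithLp.linearEquiv 2 ℝ (H × H)).symm.toLinearMap
  have hK : ∀ p : WithLp 2 (H × H), p ∈ K ↔ (p.fst, p.snd) ∈ L.conjGraph := by
    intro p
    constructor
    · rintro ⟨q, hq, rfl⟩
      exact hq
    · intro h
      exact ⟨_, h, rfl⟩
  have hc : IsClosed (K : Set (WithLp 2 (H × H))) := by
    have : (K : Set (WithLp 2 (H × H))) =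
        (WithLp.homeomorphProd 2 H H) ⁻¹' (L.conjGraph : Set (H × H)) := by
      ext p
      exact hK p
    rw [this]
    exact L.isClosed_conjGraph.preimage (WithLp.homeomorphProd 2 H H).continuous
  have : CompleteSpace K := hc.completeSpace_coe
  let p := K.starProjection (WithLp.toLp 2 (z, (0 : H)))
  have hp : p ∈ K := Submodule.starProjection_apply_mem _ _
  have ho : WithLp.toLp 2 (z, (0 : H)) - p ∈ Kᗮ := Submodule.sub_starProjection_mem_orthogonal _
  refine ⟨p.fst, (L.mem_graph_modularOperator_iff _ _).2 ⟨p.snd, (hK p).1 hp, ?_⟩⟩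
  rintro ⟨v, w⟩ hvw
  have := (Submodule.mem_orthogonal' _ _).1 ho (WithLp.toLp 2 (v, w)) ((hK _).2 hvw)
  rw [WithLp.prod_inner_apply] at this
  change (⟪z - p.fst, v⟫).re + (⟪0 - p.snd, w⟫).re = 0 at this
  simp only [zero_sub, inner_neg_left, neg_re] at this
  linarith

/-- Here `z = (1 + δ) x`, and positivity of `δ` gives `‖x‖² ≤ Re (z, x)`. The bound provides both
injectivity of `1 + δ` and continuity of its inverse. -/
lemma norm_le_of_mem_graph (L : StandardSubspace H) {x z : H}
    (h : (x, z - x) ∈ L.modularOperator.graph) : ‖x‖ ≤ ‖z‖ := by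
  have h1 := L.re_inner_nonneg_modularOperator h
  rw [inner_sub_left, sub_re] at h1
  have h2 : (⟪x, x⟫).re = ‖x‖ ^ 2 := inner_self_eq_norm_sq (𝕜 := ℂ) x
  have h3 : (⟪z, x⟫).re ≤ ‖z‖ * ‖x‖ := re_inner_le_norm (𝕜 := ℂ) z x
  by_contra! h4
  nlinarith [norm_nonneg z, norm_nonneg x]

/-- The map `x ↦ x + δ x`. -/
noncomputable def oneAddModular (L : StandardSubspace H) : L.modularOperator.domain →ₗ[ℂ] H :=
  L.modularOperator.domain.subtype + L.modularOperator.toFun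

lemma mem_graph_oneAddModular (L : StandardSubspace H) (x : L.modularOperator.domain) :
    ((x : H), L.oneAddModular x - x) ∈ L.modularOperator.graph := by
  have : L.oneAddModular x - x = L.modularOperator x := by
    change (x : H) + L.modularOperator x - x = _
    abel
  rw [this]
  exact L.modularOperator.mem_graph x

lemma bijective_oneAddModular (L : StandardSubspace H) : Function.Bijective L.oneAddModular := by
  constructor
  · rw [← LinearMap.ker_eq_bot, LinearMap.ker_eq_bot']
    intro x hx
    have h1 := L.norm_le_of_mem_graph (L.mem_graph_oneAddModular x)
    rw [hx, norm_zero] at h1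
    exact Subtype.ext (norm_le_zero_iff.1 h1)
  · intro z
    obtain ⟨x, hx⟩ := L.exists_add_modularOperator_eq z
    obtain ⟨⟨a, ha⟩, h1, h2⟩ := (LinearPMap.mem_graph_iff _).1 hx
    obtain rfl : a = x := h1
    refine ⟨⟨a, ha⟩, ?_⟩
    change a + L.modularOperator ⟨a, ha⟩ = z
    rw [h2]
    simp

lemma oneAddModular_symm_apply (L : StandardSubspace H) (z : H) :
    L.oneAddModular ((LinearEquiv.ofBijective _ L.bijective_oneAddModular).symm z) = z :=
  (LinearEquiv.ofBijective _ L.bijective_oneAddModular).apply_symm_apply z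

/-- The resolvent `(1 + δ)⁻¹`. -/
noncomputable def resolvent (L : StandardSubspace H) : H →L[ℂ] H :=
  LinearMap.mkContinuous
    (L.modularOperator.domain.subtype ∘ₗ
      (LinearEquiv.ofBijective _ L.bijective_oneAddModular).symm.toLinearMap) 1 fun z => by
    have := L.norm_le_of_mem_graph (L.mem_graph_oneAddModular
      ((LinearEquiv.ofBijective _ L.bijective_oneAddModular).symm z))
    rw [oneAddModular_symm_apply] at this
    simpa using this

lemma resolvent_mem_graph (L : StandardSubspace H) (z : H) :
    (L.resolvent z, z - L.resolvent z) ∈ L.modularOperator.graph := by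
  have := L.mem_graph_oneAddModular
      ((LinearEquiv.ofBijective _ L.bijective_oneAddModular).symm z)
  rwa [oneAddModular_symm_apply] at this

lemma resolvent_eq_of_mem_graph (L : StandardSubspace H) {x z : H}
    (h : (x, z - x) ∈ L.modularOperator.graph) : L.resolvent z = x := by
  have h1 := L.modularOperator.graph.sub_mem (L.resolvent_mem_graph z) h
  have h2 : (L.resolvent z - x, (0 : H) - (L.resolvent z - x)) ∈ L.modularOperator.graph := by
    convert h1 using 1
    ext <;> simp
  have := L.norm_le_of_mem_graph h2
  rw [norm_zero] at this
  exact sub_eq_zero.1 (norm_le_zero_iff.1 this)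

/-- `s (1 + δ)⁻¹ = δ (1 + δ)⁻¹ s`. -/
lemma resolvent_mem_conjGraph (L : StandardSubspace H) {x y : H} (h : (x, y) ∈ L.conjGraph) :
    (L.resolvent x, y - L.resolvent y) ∈ L.conjGraph := by
  -- Here `w = s B x` and `s* w = x - B x`. Since `s` and `s*` are involutions, `s (y - w) = x - B
  -- x` and `s* (x - B x) = w`. Hence `δ (y - w) = w`, which says `B y = y - w`.
  obtain ⟨w, h1, h2⟩ := (L.mem_graph_modularOperator_iff _ _).1 (L.resolvent_mem_graph x)
  have h3 := L.conjGraph.sub_mem h h1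
  have h4 : L.resolvent y = y - w := by
    apply L.resolvent_eq_of_mem_graph
    rw [mem_graph_modularOperator_iff]
    refine ⟨x - L.resolvent x, L.conjGraph_swap h3, ?_⟩
    rw [sub_sub_cancel]
    exact h2.swap
  rw [h4, sub_sub_cancel]
  exact h1

open Polynomial in
-- Iteration of `s B = (1 - B) s`. The coefficients are real because `s` is antilinear and would
-- conjugate complex ones.
lemma aeval_resolvent_mem_conjGraph (L : StandardSubspace H) (p : ℝ[X]) {x y : H}
    (h : (x, y) ∈ L.conjGraph) :
    (aeval L.resolvent p x, aeval (1 - L.resolvent) p y) ∈ L.conjGraph := by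
  induction p using Polynomial.induction_on' generalizing x y with
  | add p q hp hq =>
    rw [map_add, map_add]
    exact L.conjGraph.add_mem (hp h) (hq h)
  | monomial n a =>
    have key : ∀ n : ℕ, ((L.resolvent ^ n) x, ((1 - L.resolvent) ^ n) y) ∈ L.conjGraph := by
      intro n
      induction n with
      | zero => simpa using h
      | succ n ih =>
        rw [pow_succ', pow_succ']
        exact L.resolvent_mem_conjGraph ih
    have := L.conjGraph.smul_mem a (key n)
    simpa [aeval_monomial, Algebra.algebraMap_eq_smul_one] using this

open Polynomial in
/-- The symmetry of the modular operator under `δ ↦ δ⁻¹` on vectors of `L`. -/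
lemma re_inner_aeval_resolvent (L : StandardSubspace H) (p : ℝ[X]) {f : H}
    (hf : f ∈ L.toClosedSubmodule) :
    (⟪f, (1 - L.resolvent) (aeval L.resolvent p f)⟫).re =
      (⟪f, (1 - L.resolvent) (aeval (1 - L.resolvent) p f)⟫).re := by
  -- With `x = p(B) f` and `s f = f`, the intertwining relation gives `s B x = (1 - B) p(1 - B) f`.
  -- On the other hand `s* s B x = δ B x = (1 - B) x`; pairing this with `f = s f` moves `s*` away.
  have h1 := L.aeval_resolvent_mem_conjGraph p (L.mem_conjGraph_self hf)
  have h2 := L.resolvent_mem_conjGraph h1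
  obtain ⟨w, h3, h4⟩ :=
    (L.mem_graph_modularOperator_iff _ _).1 (L.resolvent_mem_graph (aeval L.resolvent p f))
  have h5 := L.conjGraph.sub_mem h2 h3
  have h6 := L.conjGraph_single _ h5 (by simp)
  have h7 : w = (1 - L.resolvent) (aeval (1 - L.resolvent) p f) := (sub_eq_zero.1 h6).symm
  subst h7
  have h8 := h4 _ (L.mem_conjGraph_self hf)
  rw [← inner_conj_symm, conj_re, ← inner_conj_symm f, conj_re]
  exact h8

lemma isSelfAdjoint_resolvent (L : StandardSubspace H) : IsSelfAdjoint L.resolvent := by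
  rw [ContinuousLinearMap.isSelfAdjoint_iff_isSymmetric]
  intro x y
  have := L.inner_modularOperator (L.resolvent_mem_graph x) (L.resolvent_mem_graph y)
  rw [inner_sub_left, inner_sub_right] at this
  exact (sub_left_injective this).symm

lemma norm_resolvent_le (L : StandardSubspace H) : ‖L.resolvent‖ ≤ 1 :=
  LinearMap.mkContinuous_norm_le _ zero_le_one _

lemma re_inner_resolvent_nonneg (L : StandardSubspace H) (x : H) :
    0 ≤ (⟪L.resolvent x, x⟫).re := by
  have h := L.re_inner_nonneg_modularOperator (L.resolvent_mem_graph x)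
  rw [inner_sub_left, sub_re] at h
  have h2 : 0 ≤ (⟪L.resolvent x, L.resolvent x⟫).re := inner_self_nonneg (𝕜 := ℂ)
  rw [← inner_conj_symm, conj_re]
  linarith

lemma resolvent_injective (L : StandardSubspace H) {x : H} (h : L.resolvent x = 0) : x = 0 := by
  have h1 := L.resolvent_mem_graph x
  rw [h, sub_zero] at h1
  exact L.modularOperator.graph_fst_eq_zero_snd h1 rfl

/-- `x = B x` means `δ B x = 0`, so injectivity of `δ` applies. This will exclude mass at `u = 1`,
that is at `t = 0`. -/
lemma one_sub_resolvent_injective (L : StandardSubspace H) {x : H} (h : (1 - L.resolvent) x = 0) :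
    x = 0 := by
  have h0 : x - L.resolvent x = 0 := h
  have h1 := L.resolvent_mem_graph x
  rw [h0] at h1
  have := L.modularOperator_injective h1
  rwa [this, sub_zero] at h0

end StandardSubspace

end Modular

/-! ### Spectral measures of bounded self-adjoint operators -/

section BoundedSpectral

open MeasureTheory Filter Topology Set
open scoped ComplexInnerProductSpace

lemma tendsto_zero_of_mem_closure {H : Type*} [NormedAddCommGroup H] [InnerProductSpace ℂ H]
    {S : ℕ → H →L[ℂ] H} {D : Set H} (hS : ∀ n x, ‖S n x‖ ≤ ‖x‖)
    (hD : ∀ x ∈ D, Tendsto (fun n => S n x) atTop (𝓝 0)) {x : H} (hx : x ∈ closure D) :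
    Tendsto (fun n => S n x) atTop (𝓝 0) := by
  rw [Metric.tendsto_atTop]
  intro ε hε
  obtain ⟨y, hy, hxy⟩ := Metric.mem_closure_iff.1 hx (ε / 2) (half_pos hε)
  obtain ⟨N, hN⟩ := Metric.tendsto_atTop.1 (hD y hy) (ε / 2) (half_pos hε)
  refine ⟨N, fun n hn => ?_⟩
  have h1 := hN n hn
  rw [dist_zero_right] at h1 ⊢
  have h2 := hS n (x - y)
  rw [dist_eq_norm] at hxy
  calc ‖S n x‖ = ‖S n (x - y) + S n y‖ := by rw [map_sub, sub_add_cancel]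
    _ ≤ ‖S n (x - y)‖ + ‖S n y‖ := norm_add_le _ _
    _ < ε := by linarith

variable {H : Type*} [NormedAddCommGroup H] [InnerProductSpace ℂ H] [CompleteSpace H]

lemma IsSelfAdjoint.inner_apply_left {T : H →L[ℂ] H} (hT : IsSelfAdjoint T) (x y : H) :
    ⟪T x, y⟫ = ⟪x, T y⟫ :=
  ContinuousLinearMap.isSelfAdjoint_iff_isSymmetric.1 hT x y

lemma IsSelfAdjoint.re_inner_mul_self {T : H →L[ℂ] H} (hT : IsSelfAdjoint T) (x : H) :
    (⟪x, (T * T) x⟫).re = ‖T x‖ ^ 2 := by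
  rw [mul_apply_eq_comp, ← hT.inner_apply_left]
  exact inner_self_eq_norm_sq (𝕜 := ℂ) _

/-- The spectral measure of a bounded self-adjoint operator exists. -/
lemma exists_boundedSpectralMeasure {B : H →L[ℂ] H} (hB : IsSelfAdjoint B) (x : H) :
    ∃ ν : Measure ℝ, IsFiniteMeasure ν ∧ ν (spectrum ℝ B)ᶜ = 0 ∧
      ∀ g : ℝ → ℝ, Continuous g → ∫ u, g u ∂ν = (⟪x, cfc g B x⟫).re := by
  -- Riesz–Markov for the functional `g ↦ (x, g(B) x)` on the compact spectrum. It is positive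
  -- because `g = k²` gives `‖k(B) x‖²`. The resulting measure is pushed forward to `ℝ`.
  let Λ₀ : C(spectrum ℝ B, ℝ) →ₗ[ℝ] ℝ :=
    { toFun := fun g => (⟪x, cfcHom hB g x⟫).re
      map_add' := fun g h => by simp
      map_smul' := fun c g => by simp }
  have hpos : ∀ g : C(spectrum ℝ B, ℝ), 0 ≤ g → 0 ≤ Λ₀ g := by
    intro g hg
    let k : C(spectrum ℝ B, ℝ) := ⟨fun u => √(g u), by fun_prop⟩
    have hk : g = k * k := by
      ext u
      exact (Real.mul_self_sqrt (hg u)).symm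
    change 0 ≤ (⟪x, cfcHom hB g x⟫).re
    rw [hk, map_mul, IsSelfAdjoint.re_inner_mul_self]
    · positivity
    · exact cfcHom_predicate hB k
  let Λ : CompactlySupportedContinuousMap (spectrum ℝ B) ℝ →ₚ[ℝ] ℝ := PositiveLinearMap.mk₀
    { toFun := fun g => Λ₀ g
      map_add' := fun g h => Λ₀.map_add g h
      map_smul' := fun c g => Λ₀.map_smul c g } fun g hg => hpos g hg
  have hΛ : ∀ g : C(spectrum ℝ B, ℝ), ∫ u, g u ∂(RealRMK.rieszMeasure Λ) = Λ₀ g := fun g =>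
    RealRMK.integral_rieszMeasure Λ (CompactlySupportedContinuousMap.continuousMapEquiv g)
  have hm : MeasurableEmbedding (Subtype.val : spectrum ℝ B → ℝ) :=
    MeasurableEmbedding.subtype_coe (spectrum.isClosed B).measurableSet
  refine ⟨(RealRMK.rieszMeasure Λ).map Subtype.val, ?_, ?_, ?_⟩
  · infer_instance
  · rw [hm.map_apply]
    simp
  · intro g hg
    rw [hm.integral_map, cfc_apply g B hB hg.continuousOn]
    exact hΛ ⟨_, hg.continuousOn.domRestrict⟩

/-- The spectral measure at `x` of a bounded self-adjoint operator. -/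
noncomputable def boundedSpectralMeasure {B : H →L[ℂ] H} (hB : IsSelfAdjoint B) (x : H) :
    Measure ℝ :=
  (exists_boundedSpectralMeasure hB x).choose

section

variable {B : H →L[ℂ] H} (hB : IsSelfAdjoint B) (x : H)

instance : IsFiniteMeasure (boundedSpectralMeasure hB x) :=
  (exists_boundedSpectralMeasure hB x).choose_spec.1

lemma ae_mem_spectrum_boundedSpectralMeasure :
    ∀ᵐ u ∂(boundedSpectralMeasure hB x), u ∈ spectrum ℝ B :=
  (exists_boundedSpectralMeasure hB x).choose_spec.2.1

lemma integral_boundedSpectralMeasure {g : ℝ → ℝ} (hg : Continuous g) :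
    ∫ u, g u ∂(boundedSpectralMeasure hB x) = (⟪x, cfc g B x⟫).re :=
  (exists_boundedSpectralMeasure hB x).choose_spec.2.2 g hg

lemma integrable_boundedSpectralMeasure {g : ℝ → ℝ} (hg : Continuous g) :
    Integrable g (boundedSpectralMeasure hB x) := by
  obtain ⟨C, hC⟩ := (spectrum.isCompact B).exists_bound_of_continuousOn hg.continuousOn
  exact Integrable.of_bound hg.aestronglyMeasurable C
    ((ae_mem_spectrum_boundedSpectralMeasure hB x).mono hC)

/-- Translates vanishing, bounds and convergence of `g(B) x` into statements about integrals. -/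
lemma norm_cfc_apply_sq {g : ℝ → ℝ} (hg : Continuous g) :
    ‖cfc g B x‖ ^ 2 = ∫ u, g u ^ 2 ∂(boundedSpectralMeasure hB x) := by
  rw [integral_boundedSpectralMeasure hB x (g := fun u => g u ^ 2) (hg.pow 2),
    ← (cfc_predicate g B : IsSelfAdjoint _).re_inner_mul_self, ← sq,
    cfc_pow g 2 B hg.continuousOn]

lemma integral_one_boundedSpectralMeasure :
    ∫ _, (1 : ℝ) ∂(boundedSpectralMeasure hB x) = ‖x‖ ^ 2 := by
  rw [integral_boundedSpectralMeasure hB x continuous_const, cfc_const_one ℝ B]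
  exact inner_self_eq_norm_sq (𝕜 := ℂ) _

lemma norm_cfc_apply_le {B : H →L[ℂ] H} (hB : IsSelfAdjoint B) (x : H)
    {g : ℝ → ℝ} (hg : Continuous g) {C : ℝ} (hC : 0 ≤ C)
    (h : ∀ u, |g u| ≤ C) : ‖cfc g B x‖ ≤ C * ‖x‖ := by
  refine le_of_sq_le_sq ?_ (by positivity)
  rw [norm_cfc_apply_sq hB x hg, mul_pow, ← integral_one_boundedSpectralMeasure hB x,
    ← integral_const_mul]
  refine integral_mono (integrable_boundedSpectralMeasure hB x (hg.pow 2))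
    (integrable_boundedSpectralMeasure hB x continuous_const) fun u => ?_
  simp only [mul_one]
  exact sq_le_sq.2 ((h u).trans (le_abs_self C))

end

/-- The orthogonal projection onto the kernel of a bounded operator. -/
noncomputable def kerProj (T : H →L[ℂ] H) : H →L[ℂ] H :=
  have : CompleteSpace T.ker := T.isClosed_ker.completeSpace_coe
  T.ker.starProjection

section

variable (T : H →L[ℂ] H)

instance : T.ker.HasOrthogonalProjection :=
  have : CompleteSpace T.ker := T.isClosed_ker.completeSpace_coe
  inferInstance

lemma isStarProjection_kerProj : IsStarProjection (kerProj T) :=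
  isStarProjection_starProjection

lemma apply_kerProj (x : H) : T (kerProj T x) = 0 :=
  T.ker.starProjection_apply_mem x

lemma kerProj_eq_self {x : H} (h : T x = 0) : kerProj T x = x :=
  Submodule.starProjection_eq_self_iff.2 h

lemma sub_kerProj_mem_closure_range {T : H →L[ℂ] H} (hT : IsSelfAdjoint T) (x : H) :
    x - kerProj T x ∈ closure (range T) := by
  have h : x - kerProj T x ∈ T.kerᗮ := Submodule.sub_starProjection_mem_orthogonal x
  rw [T.orthogonal_ker, ← ContinuousLinearMap.star_eq_adjoint, hT.star_eq] at h
  exact h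

lemma re_inner_kerProj (x : H) : (⟪x, kerProj T x⟫).re = ‖kerProj T x‖ ^ 2 := by
  rw [← (isStarProjection_kerProj T).isSelfAdjoint.re_inner_mul_self,
    (isStarProjection_kerProj T).isIdempotentElem.eq]

end

/-- The spectral measure of the zero set of `h` is given by the projection onto the kernel of
`h(B)`. -/
lemma boundedSpectralMeasure_zeros {B : H →L[ℂ] H} (hB : IsSelfAdjoint B) (x : H) {h : ℝ → ℝ}
    (hh : Continuous h) :
    (boundedSpectralMeasure hB x).real {u | h u = 0} = ‖kerProj (cfc h B) x‖ ^ 2 := by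
  set P := kerProj (cfc h B) with hP
  -- These functions decrease to the indicator of the zero set of `h`. The operators `g_n(B)` fix
  -- the kernel of `h(B)`, and tend strongly to zero on the closure of its range because `|g_n h| ≤
  -- 1 / n`.
  let g : ℕ → ℝ → ℝ := fun n u => max 0 (1 - n * |h u|)
  have hg : ∀ n, Continuous (g n) := fun n => by fun_prop
  have hg1 : ∀ n u, |g n u| ≤ 1 := by
    intro n u
    rw [abs_of_nonneg (le_max_left _ _)]
    exact max_le zero_le_one (sub_le_self _ (by positivity))
  have hgh : ∀ (n : ℕ) u, |g (n + 1) u * h u| ≤ 1 / ((n : ℝ) + 1) := by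
    intro n u
    rw [abs_mul]
    by_cases hc : 1 ≤ ((n + 1 : ℕ) : ℝ) * |h u|
    · have : g (n + 1) u = 0 := max_eq_left (by linarith)
      rw [this]
      simp
      positivity
    · push_cast at hc
      rw [le_div_iff₀ (by positivity)]
      have := hg1 (n + 1) u
      have h0 : 0 ≤ |h u| * ((n : ℝ) + 1) := by positivity
      nlinarith
  -- If `h(B) p = 0`, then `h = 0`, and so `g_n = 1`, almost everywhere for the spectral measure of
  -- `p`.
  have hker : ∀ n p, cfc h B p = 0 → cfc (g n) B p = p := by
    intro n p hp
    have h1 := norm_cfc_apply_sq hB p hh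
    rw [hp, norm_zero, zero_pow two_ne_zero, eq_comm, integral_eq_zero_iff_of_nonneg
      (fun u => sq_nonneg _) (integrable_boundedSpectralMeasure hB p (hh.pow 2))] at h1
    have h2 := norm_cfc_apply_sq hB p (g := fun u => g n u - 1) ((hg n).sub continuous_const)
    have h3 : ∫ u, (g n u - 1) ^ 2 ∂(boundedSpectralMeasure hB p) = 0 := by
      refine integral_eq_zero_of_ae (h1.mono fun u hu => ?_)
      have : h u = 0 := by simpa using hu
      simp [g, this]
    rw [h3, cfc_sub (g n) (fun _ => 1) B (hg n).continuousOn continuousOn_const,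
      cfc_const_one ℝ B] at h2
    exact sub_eq_zero.1 (norm_eq_zero.1 (pow_eq_zero_iff two_ne_zero |>.1 h2))
  have hran : Tendsto (fun n => cfc (g (n + 1)) B (x - P x)) atTop (𝓝 0) := by
    refine tendsto_zero_of_mem_closure (D := range (cfc h B : H →L[ℂ] H))
      (fun n y => (norm_cfc_apply_le hB y (hg _) zero_le_one (hg1 _)).trans_eq (one_mul _)) ?_
      (sub_kerProj_mem_closure_range (cfc_predicate h B) x)
    rintro _ ⟨y, rfl⟩
    refine squeeze_zero_norm (a := fun n : ℕ => 1 / ((n : ℝ) + 1) * ‖y‖) (fun n => ?_) ?_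
    · change ‖(cfc (g (n + 1)) B * cfc h B : H →L[ℂ] H) y‖ ≤ _
      rw [← cfc_mul (g (n + 1)) h B (hg _).continuousOn hh.continuousOn]
      exact norm_cfc_apply_le hB y ((hg _).mul hh) (by positivity) (hgh n)
    · simpa using tendsto_one_div_add_atTop_nhds_zero_nat.mul_const ‖y‖
  have hlim : Tendsto (fun n => (⟪x, cfc (g (n + 1)) B x⟫).re) atTop (𝓝 (‖P x‖ ^ 2)) := by
    have h1 : ∀ n, ⟪x, cfc (g (n + 1)) B x⟫ = ⟪x, P x⟫ + ⟪x, cfc (g (n + 1)) B (x - P x)⟫ := by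
      intro n
      rw [map_sub, hker _ (P x) (apply_kerProj _ x), ← inner_add_right, add_sub_cancel]
    have h2 : Tendsto (fun n => ⟪x, P x⟫ + ⟪x, cfc (g (n + 1)) B (x - P x)⟫) atTop
        (𝓝 (⟪x, P x⟫ + ⟪x, 0⟫)) := tendsto_const_nhds.add (tendsto_const_nhds.inner hran)
    simp_rw [h1]
    rw [inner_zero_right, add_zero] at h2
    rw [hP, ← re_inner_kerProj]
    exact (Complex.continuous_re.tendsto _).comp h2
  have hms : MeasurableSet {u | h u = 0} := (isClosed_eq hh continuous_const).measurableSet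
  have hlim2 : Tendsto (fun n => ∫ u, g (n + 1) u ∂(boundedSpectralMeasure hB x)) atTop
      (𝓝 (∫ u, {u | h u = 0}.indicator 1 u ∂(boundedSpectralMeasure hB x))) := by
    refine tendsto_integral_of_dominated_convergence (fun _ => 1)
      (fun n => (hg _).aestronglyMeasurable) (integrable_const _)
      (fun n => ae_of_all _ (hg1 _)) (ae_of_all _ fun u => ?_)
    by_cases hu : h u = 0
    · simp [g, hu]
    · rw [indicator_of_notMem (by simpa using hu)]
      obtain ⟨N, hN⟩ := exists_nat_ge (1 / |h u|)
      refine tendsto_const_nhds.congr' ?_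
      filter_upwards [eventually_ge_atTop N] with n hn
      have h1 : 0 < |h u| := abs_pos.2 hu
      have h2 : (N : ℝ) ≤ n := by exact_mod_cast hn
      rw [div_le_iff₀ h1] at hN
      refine (max_eq_left ?_).symm
      push_cast
      nlinarith
  simp_rw [integral_boundedSpectralMeasure hB x (hg _)] at hlim2
  rw [integral_indicator_one hms] at hlim2
  exact tendsto_nhds_unique hlim2 hlim

end BoundedSpectral

/-! ### The spectral resolution of `B⁻¹ - 1` -/

section UnboundedSpectral

open MeasureTheory Filter Topology Set
open scoped ComplexInnerProductSpace

/-- `S` is the pointwise limit of the half-lines along `l`. The limits required of a resolution of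
the identity are the cases `∅`, `ℝ` and `Iic t`. -/
lemma tendsto_measureReal_Iic (m : Measure ℝ) [IsFiniteMeasure m] {l : Filter ℝ}
    [l.IsCountablyGenerated] {S : Set ℝ}
    (h : ∀ u, ∀ᶠ s in l, u ≤ s ↔ u ∈ S) :
    Tendsto (fun s => m.real (Iic s)) l (𝓝 (m.real S)) :=
  (ENNReal.tendsto_toReal (measure_ne_top m S)).comp
    (tendsto_measure_of_tendsto_indicator_of_isFiniteMeasure l m (fun _ => measurableSet_Iic) h)

lemma tendsto_measureReal_Iic_atBot (m : Measure ℝ) [IsFiniteMeasure m] :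
    Tendsto (fun s => m.real (Iic s)) atBot (𝓝 0) := by
  simpa using tendsto_measureReal_Iic m (l := atBot) (S := ∅) fun u => by
    filter_upwards [Iio_mem_atBot u] with s hs
    simpa using hs

lemma tendsto_measureReal_Iic_atTop (m : Measure ℝ) [IsFiniteMeasure m] :
    Tendsto (fun s => m.real (Iic s)) atTop (𝓝 (m.real univ)) :=
  tendsto_measureReal_Iic m fun u => by
    filter_upwards [Ici_mem_atTop u] with s hs
    simpa using hs

lemma tendsto_measureReal_Iic_right (m : Measure ℝ) [IsFiniteMeasure m] (t : ℝ) :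
    Tendsto (fun s => m.real (Iic s)) (𝓝[≥] t) (𝓝 (m.real (Iic t))) :=
  tendsto_measureReal_Iic m fun u => by
    by_cases hu : u ≤ t
    · filter_upwards [self_mem_nhdsWithin] with s hs
      simp [hu, hu.trans hs]
    · filter_upwards [mem_nhdsWithin_of_mem_nhds (Iio_mem_nhds (not_le.1 hu))] with s hs
      simp only [mem_Iic, hu, iff_false, not_le]
      exact hs

lemma tendsto_of_norm_sub_sq {E : Type*} [NormedAddCommGroup E] {l : Filter ℝ} {F : ℝ → E} {x : E}
    (h : Tendsto (fun s => ‖F s - x‖ ^ 2) l (𝓝 0)) : Tendsto F l (𝓝 x) := by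
  rw [tendsto_iff_norm_sub_tendsto_zero]
  simpa using h.sqrt

lemma cauchySeq_of_norm_sub_sq_le {E : Type*} [NormedAddCommGroup E] {y : ℕ → E} {a : ℕ → ℝ}
    (ha : Tendsto a atTop (𝓝 0))
    (h : ∀ n m, ‖y n - y m‖ ^ 2 ≤ a n + a m) : CauchySeq y := by
  rw [Metric.cauchySeq_iff]
  intro ε hε
  obtain ⟨N, hN⟩ := (ha.eventually
    (gt_mem_nhds (show 0 < ε ^ 2 / 2 by positivity))).exists_forall_of_atTop
  refine ⟨N, fun m hm n hn => ?_⟩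
  rw [dist_eq_norm]
  refine lt_of_pow_lt_pow_left₀ 2 hε.le ?_
  linarith [h m n, hN m hm, hN n hn]

/-- The hypothesis `hA` is the form in which `B = (1 + A)⁻¹` is used from here on. -/
lemma mem_domain_iff_exists_resolvent {H : Type*} [NormedAddCommGroup H] [InnerProductSpace ℂ H]
    {B : H →L[ℂ] H} {A : H →ₗ.[ℂ] H}
    (hA : ∀ x z, (x, z) ∈ A.graph ↔ B (x + z) = x) (x : H) : x ∈ A.domain ↔ ∃ y, B y = x := by
  constructor
  · intro hx
    exact ⟨_, (hA _ _).1 (A.mem_graph ⟨x, hx⟩)⟩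
  · rintro ⟨y, hy⟩
    refine LinearPMap.mem_domain_of_mem_graph (y := y - x) ?_
    rw [hA]
    simpa using hy

variable {H : Type*} [NormedAddCommGroup H] [InnerProductSpace ℂ H] [CompleteSpace H]

namespace ResolutionOfIdentity

variable (e : ResolutionOfIdentity H)

lemma distribution_apply (x : H) (t : ℝ) : e.distribution x t = ‖e.proj t x‖ ^ 2 :=
  e.inner_proj x t

lemma spectralMeasure_Iic (x : H) (t : ℝ) :
    e.spectralMeasure x (Iic t) = ENNReal.ofReal (‖e.proj t x‖ ^ 2) := by
  have h : Tendsto (e.distribution x) atBot (𝓝 0) := by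
    have := ((e.tendsto_atBot x).norm).pow 2
    simp only [norm_zero, ne_eq, OfNat.ofNat_ne_zero, not_false_eq_true, zero_pow] at this
    exact this.congr fun t => (e.distribution_apply x t).symm
  rw [spectralMeasure, StieltjesFunction.measure_Iic _ h, sub_zero, distribution_apply]

instance (x : H) : IsFiniteMeasure (e.spectralMeasure x) := by
  have h : Tendsto (e.distribution x) atBot (𝓝 0) := by
    have := ((e.tendsto_atBot x).norm).pow 2
    simp only [norm_zero, ne_eq, OfNat.ofNat_ne_zero, not_false_eq_true, zero_pow] at this
    exact this.congr fun t => (e.distribution_apply x t).symm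
  have h' : Tendsto (e.distribution x) atTop (𝓝 (‖x‖ ^ 2)) :=
    ((e.tendsto_atTop x).norm.pow 2).congr fun t => (e.distribution_apply x t).symm
  constructor
  rw [spectralMeasure, StieltjesFunction.measure_univ _ h h']
  exact ENNReal.ofReal_lt_top

lemma spectralMeasure_eq {x : H} {m : Measure ℝ} [IsFiniteMeasure m]
    (h : ∀ t, m.real (Iic t) = ‖e.proj t x‖ ^ 2) : e.spectralMeasure x = m := by
  refine Measure.ext_of_Iic _ _ fun t => ?_
  rw [spectralMeasure_Iic, ← h, ofReal_measureReal]

end ResolutionOfIdentity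

section

variable {B : H →L[ℂ] H} (hB : IsSelfAdjoint B)

/-- The function with zero set `{u | 1 / (1 + t) ≤ u}` for `t > -1`. -/
def resolventThreshold (t u : ℝ) : ℝ := max 0 (1 - (1 + t) * u)

@[fun_prop]
lemma continuous_resolventThreshold (t : ℝ) : Continuous (resolventThreshold t) := by
  unfold resolventThreshold
  fun_prop

lemma resolventThreshold_nonneg (t u : ℝ) : 0 ≤ resolventThreshold t u := le_max_left _ _

lemma resolventThreshold_eq_zero_iff {t u : ℝ} : resolventThreshold t u = 0 ↔ 1 ≤ (1 + t) * u := by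
  rw [resolventThreshold, max_eq_left_iff, sub_nonpos]

/-- The spectral projection of `B⁻¹ - 1` onto `(-∞, t]`. -/
noncomputable def resolventProj (B : H →L[ℂ] H) (t : ℝ) : H →L[ℂ] H :=
  kerProj (cfc (resolventThreshold t) B)

/-- The mass at `0` belongs to the projection onto `ker B = 0`. Hence the convention `0⁻¹ = 0` never
matters for `u⁻¹ - 1`. -/
lemma ae_pos_boundedSpectralMeasure (hs : spectrum ℝ B ⊆ Icc 0 1) (hi : ∀ x, B x = 0 → x = 0)
    (x : H) : ∀ᵐ u ∂(boundedSpectralMeasure hB x), u ∈ Ioc (0 : ℝ) 1 := by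
  have h := boundedSpectralMeasure_zeros hB x (h := fun u => u) continuous_id
  rw [cfc_id' ℝ B, hi _ (apply_kerProj B x), norm_zero, zero_pow two_ne_zero,
    measureReal_eq_zero_iff] at h
  have h' : ∀ᵐ u ∂(boundedSpectralMeasure hB x), u ≠ 0 := by
    rw [ae_iff]
    simpa using h
  filter_upwards [h', ae_mem_spectrum_boundedSpectralMeasure hB x] with u h1 h2
  exact ⟨lt_of_le_of_ne (hs h2).1 h1.symm, (hs h2).2⟩

/-- The spectral measure of `B⁻¹ - 1`. -/
noncomputable def resolventMeasure (x : H) : Measure ℝ :=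
  (boundedSpectralMeasure hB x).map fun u => u⁻¹ - 1

lemma measurable_inv_sub_one : Measurable fun u : ℝ => u⁻¹ - 1 := by fun_prop

instance (x : H) : IsFiniteMeasure (resolventMeasure hB x) := by
  unfold resolventMeasure
  infer_instance

/-- For `u > 0` the condition `u⁻¹ - 1 ≤ t` reads `1 ≤ (1 + t) u`. This needs no case distinction:
for `t ≤ -1` both are false. -/
lemma resolventMeasure_Iic (hs : spectrum ℝ B ⊆ Icc 0 1) (hi : ∀ x, B x = 0 → x = 0)
    (x : H) (t : ℝ) : (resolventMeasure hB x).real (Iic t) = ‖resolventProj B t x‖ ^ 2 := by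
  rw [resolventProj, ← boundedSpectralMeasure_zeros hB x (continuous_resolventThreshold t),
    resolventMeasure, map_measureReal_apply measurable_inv_sub_one measurableSet_Iic]
  refine measureReal_congr ?_
  filter_upwards [ae_pos_boundedSpectralMeasure hB hs hi x] with u hu
  refine propext ?_
  change u⁻¹ - 1 ≤ t ↔ resolventThreshold t u = 0
  rw [resolventThreshold_eq_zero_iff, sub_le_iff_le_add', inv_le_iff_one_le_mul₀ hu.1]

lemma resolventMeasure_univ (x : H) : (resolventMeasure hB x).real univ = ‖x‖ ^ 2 := by
  rw [resolventMeasure, map_measureReal_apply measurable_inv_sub_one MeasurableSet.univ,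
    ← integral_one_boundedSpectralMeasure hB x]
  simp

/-- On the spectrum `u ≥ 0`, so the threshold functions decrease in `t` and their kernels grow. -/
lemma ker_resolventThreshold_mono {B : H →L[ℂ] H} (hB : IsSelfAdjoint B)
    (hs : spectrum ℝ B ⊆ Icc 0 1) {s t : ℝ} (hst : s ≤ t) {x : H}
    (hx : cfc (resolventThreshold s) B x = 0) : cfc (resolventThreshold t) B x = 0 := by
  have h : ‖cfc (resolventThreshold t) B x‖ ^ 2 ≤ ‖cfc (resolventThreshold s) B x‖ ^ 2 := by
    rw [norm_cfc_apply_sq hB x (continuous_resolventThreshold _),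
      norm_cfc_apply_sq hB x (continuous_resolventThreshold _)]
    refine integral_mono_ae
      (integrable_boundedSpectralMeasure hB x ((continuous_resolventThreshold _).pow 2))
      (integrable_boundedSpectralMeasure hB x ((continuous_resolventThreshold _).pow 2)) ?_
    filter_upwards [ae_mem_spectrum_boundedSpectralMeasure hB x] with u hu
    refine pow_le_pow_left₀ (resolventThreshold_nonneg _ _) (max_le_max_left _ ?_) 2
    have := mul_le_mul_of_nonneg_right hst (hs hu).1
    linarith
  rw [hx, norm_zero, zero_pow two_ne_zero] at h
  exact norm_eq_zero.1 (pow_eq_zero_iff two_ne_zero |>.1 (le_antisymm h (sq_nonneg _)))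

/-- `Q - P` is again a projection. This reduces strong limits of an increasing family of projections
to limits of its distribution functions. -/
lemma IsStarProjection.norm_sub_sq {P Q : H →L[ℂ] H} (hP : IsStarProjection P)
    (hQ : IsStarProjection Q) (h : P * Q = P) (x : H) :
    ‖Q x - P x‖ ^ 2 = ‖Q x‖ ^ 2 - ‖P x‖ ^ 2 := by
  have h2 : Q * P = P := by
    have := congrArg star h
    rwa [star_mul, hP.isSelfAdjoint.star_eq, hQ.isSelfAdjoint.star_eq] at this
  have hsa : IsSelfAdjoint (Q - P) := hQ.isSelfAdjoint.sub hP.isSelfAdjoint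
  have hid : (Q - P) * (Q - P) = Q - P := by
    rw [mul_sub, sub_mul, sub_mul, hQ.isIdempotentElem.eq, hP.isIdempotentElem.eq, h, h2]
    abel
  have h3 := hsa.re_inner_mul_self x
  have h4 := hQ.isSelfAdjoint.re_inner_mul_self x
  have h5 := hP.isSelfAdjoint.re_inner_mul_self x
  rw [hid, sub_apply, inner_sub_right, Complex.sub_re] at h3
  rw [hQ.isIdempotentElem.eq] at h4
  rw [hP.isIdempotentElem.eq] at h5
  rw [← h3, h4, h5]

lemma resolventProj_mul {B : H →L[ℂ] H} (hB : IsSelfAdjoint B)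
    (hs : spectrum ℝ B ⊆ Icc 0 1) {s t : ℝ} (hst : s ≤ t) :
    resolventProj B s * resolventProj B t = resolventProj B s :=
  Submodule.starProjection_comp_starProjection_of_le
    fun _ hx => ker_resolventThreshold_mono hB hs hst hx

/-- The spectral resolution of `B⁻¹ - 1`. -/
noncomputable def resolventResolution (hs : spectrum ℝ B ⊆ Icc 0 1) (hi : ∀ x, B x = 0 → x = 0) :
    ResolutionOfIdentity H where
  proj := resolventProj B
  isStarProjection t := isStarProjection_kerProj _
  monotone s t hst := resolventProj_mul hB hs hst
  rightContinuous x t := by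
    refine tendsto_of_norm_sub_sq ?_
    have h := (tendsto_measureReal_Iic_right (resolventMeasure hB x) t).sub_const
      ((resolventMeasure hB x).real (Iic t))
    rw [sub_self] at h
    refine h.congr' ?_
    filter_upwards [self_mem_nhdsWithin] with s hs'
    rw [resolventMeasure_Iic hB hs hi, resolventMeasure_Iic hB hs hi]
    exact ((isStarProjection_kerProj _).norm_sub_sq (isStarProjection_kerProj _)
      (resolventProj_mul hB hs hs') x).symm
  tendsto_atBot x := by
    refine tendsto_of_norm_sub_sq ?_
    refine (tendsto_measureReal_Iic_atBot (resolventMeasure hB x)).congr fun t => ?_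
    rw [resolventMeasure_Iic hB hs hi, sub_zero]
  tendsto_atTop x := by
    refine tendsto_of_norm_sub_sq ?_
    have h := (tendsto_measureReal_Iic_atTop (resolventMeasure hB x)).const_sub (‖x‖ ^ 2)
    rw [resolventMeasure_univ, sub_self] at h
    refine h.congr fun t => ?_
    rw [resolventMeasure_Iic hB hs hi, norm_sub_rev]
    exact ((isStarProjection_kerProj _).norm_sub_sq (IsStarProjection.one _) (mul_one _) x).symm

/-- The spectral measures of `g(B) x` and `x`. -/
lemma boundedSpectralMeasure_cfc_apply (x : H) {g : ℝ → ℝ} (hg : Continuous g) :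
    boundedSpectralMeasure hB (cfc g B x) =
      (boundedSpectralMeasure hB x).withDensity fun u => ENNReal.ofReal (g u ^ 2) := by
  have hf : IsFiniteMeasure
      ((boundedSpectralMeasure hB x).withDensity fun u => ENNReal.ofReal (g u ^ 2)) :=
    isFiniteMeasure_withDensity_ofReal
      (integrable_boundedSpectralMeasure hB x (hg.pow 2)).hasFiniteIntegral
  refine ext_of_forall_integral_eq_of_IsFiniteMeasure fun k => ?_
  rw [integral_boundedSpectralMeasure hB _ k.continuous,
    integral_withDensity_eq_integral_toReal_smul (by fun_prop) (by simp)]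
  have h1 : ∀ u, (ENNReal.ofReal (g u ^ 2)).toReal • k u = g u * (k u * g u) := by
    intro u
    rw [ENNReal.toReal_ofReal (sq_nonneg _), smul_eq_mul]
    ring
  simp_rw [h1]
  rw [integral_boundedSpectralMeasure hB x (g := fun u => g u * (k u * g u))
      (hg.mul (k.continuous.mul hg)),
    cfc_mul g (fun u => k u * g u) B hg.continuousOn (k.continuous.mul hg).continuousOn,
    cfc_mul k g B k.continuous.continuousOn hg.continuousOn,
    (cfc_predicate g B : IsSelfAdjoint _).inner_apply_left]
  rfl

lemma boundedSpectralMeasure_apply (x : H) :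
    boundedSpectralMeasure hB (B x) =
      (boundedSpectralMeasure hB x).withDensity fun u => ENNReal.ofReal (u ^ 2) := by
  have := boundedSpectralMeasure_cfc_apply hB x (g := fun u => u) continuous_id
  rwa [cfc_id' ℝ B] at this

lemma integrable_boundedSpectralMeasure_apply_iff (x : H) (k : ℝ → ℝ) :
    Integrable k (boundedSpectralMeasure hB (B x)) ↔
      Integrable (fun u => u ^ 2 * k u) (boundedSpectralMeasure hB x) := by
  rw [boundedSpectralMeasure_apply, integrable_withDensity_iff_integrable_smul' (by fun_prop)
    (by simp)]
  simp [ENNReal.toReal_ofReal (sq_nonneg _)]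

lemma integral_boundedSpectralMeasure_apply (x : H) (k : ℝ → ℝ) :
    ∫ u, k u ∂(boundedSpectralMeasure hB (B x)) =
      ∫ u, u ^ 2 * k u ∂(boundedSpectralMeasure hB x) := by
  rw [boundedSpectralMeasure_apply, integral_withDensity_eq_integral_toReal_smul (by fun_prop)
    (by simp)]
  simp [ENNReal.toReal_ofReal (sq_nonneg _)]

lemma re_inner_apply_sub_apply (y : H) :
    (⟪B y, y - B y⟫).re = ∫ u, (u - u ^ 2) ∂(boundedSpectralMeasure hB y) := by
  rw [integral_boundedSpectralMeasure hB y (by fun_prop), cfc_sub (fun u => u) (fun u => u ^ 2) B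
    (by fun_prop) (by fun_prop), cfc_id' ℝ B, cfc_pow_id B 2, hB.inner_apply_left, map_sub, sq]
  rfl

lemma im_inner_apply_sub_apply {B : H →L[ℂ] H} (hB : IsSelfAdjoint B) (y : H) :
    (⟪B y, y - B y⟫).im = 0 := by
  have h : (starRingEnd ℂ) ⟪B y, y - B y⟫ = ⟪B y, y - B y⟫ := by
    rw [inner_conj_symm, inner_sub_left, inner_sub_right, hB.inner_apply_left y y]
  exact Complex.conj_eq_iff_im.1 h

/-- Passing from `y` to `B y` contributes the density `u²`, which cancels the singularity of `u⁻¹ -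
1` at `0`. The same cancellation gives square integrability. -/
lemma integral_resolventMeasure (hs : spectrum ℝ B ⊆ Icc 0 1) (hi : ∀ x, B x = 0 → x = 0) (y : H) :
    ∫ t, t ∂(resolventMeasure hB (B y)) = (⟪B y, y - B y⟫).re := by
  rw [resolventMeasure, integral_map (by fun_prop) (by fun_prop),
    integral_boundedSpectralMeasure_apply, re_inner_apply_sub_apply hB]
  refine integral_congr_ae ?_
  filter_upwards [ae_pos_boundedSpectralMeasure hB hs hi y] with u hu
  have := hu.1.ne'
  field_simp

lemma integrable_sq_resolventMeasure (hs : spectrum ℝ B ⊆ Icc 0 1) (hi : ∀ x, B x = 0 → x = 0)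
    (y : H) : Integrable (fun t : ℝ => t ^ 2) (resolventMeasure hB (B y)) := by
  rw [resolventMeasure, integrable_map_measure (by fun_prop) (by fun_prop),
    integrable_boundedSpectralMeasure_apply_iff]
  refine (integrable_boundedSpectralMeasure hB y (g := fun u => (1 - u) ^ 2) (by fun_prop)).congr ?_
  filter_upwards [ae_pos_boundedSpectralMeasure hB hs hi y] with u hu
  have := hu.1.ne'
  simp only [Function.comp_apply]
  field_simp

/-- If the spectral integral of `u⁻²` is finite, the vector belongs to the range of `B`. -/
lemma exists_apply_eq_of_integrable (hs : spectrum ℝ B ⊆ Icc 0 1) (hi : ∀ x, B x = 0 → x = 0)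
    {x : H} (hx : Integrable (fun t : ℝ => t ^ 2) (resolventMeasure hB x)) : ∃ y, B y = x := by
  set ν := boundedSpectralMeasure hB x with hν
  have hpos : ∀ᵐ u ∂ν, u ∈ Ioc (0 : ℝ) 1 := ae_pos_boundedSpectralMeasure hB hs hi x
  rw [resolventMeasure, integrable_map_measure (by fun_prop) (by fun_prop)] at hx
  have hint : Integrable (fun u : ℝ => u⁻¹ ^ 2) ν := by
    -- With `a = u⁻¹`, the bound is `2 (a - 1)² + 2 - a² = (a - 2)² ≥ 0`.
    refine ((hx.const_mul 2).add (integrable_const 2)).mono' (by fun_prop) (ae_of_all _ fun u => ?_)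
    rw [Real.norm_eq_abs, abs_of_nonneg (sq_nonneg _)]
    simp only [Function.comp_apply, Pi.add_apply]
    nlinarith [sq_nonneg (u⁻¹ - 2)]
  -- Continuous truncations of `u⁻¹`. They converge to it in `L²(ν)`, so `r_n(B) x` is Cauchy; its
  -- limit is the preimage because `u r_n(u) → 1` in `L²(ν)`.
  let r : ℕ → ℝ → ℝ := fun n u => (max u (1 / ((n : ℝ) + 1)))⁻¹
  have hr : ∀ n, Continuous (r n) := fun n => by
    refine (continuous_id.max continuous_const).inv₀ fun u => ?_
    exact (lt_of_lt_of_le (by positivity) (le_max_right _ _)).ne'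
  have hr0 : ∀ n u, 0 < r n u := fun n u =>
    inv_pos.2 (lt_of_lt_of_le (by positivity) (le_max_right _ _))
  have hr1 : ∀ n u, 0 < u → r n u ≤ u⁻¹ := fun n u hu => inv_anti₀ hu (le_max_left _ _)
  have hrt : ∀ u, 0 < u → Tendsto (fun n => r n u) atTop (𝓝 u⁻¹) := by
    intro u hu
    refine tendsto_const_nhds.congr' ?_
    have := tendsto_one_div_add_atTop_nhds_zero_nat (𝕜 := ℝ) |>.eventually (gt_mem_nhds hu)
    filter_upwards [this] with n hn
    simp only [r]
    rw [max_eq_left hn.le]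
  let a : ℕ → ℝ := fun n => ∫ u, (u⁻¹ - r n u) ^ 2 ∂ν
  have hb : ∀ n u, u ∈ Ioc (0 : ℝ) 1 → ‖(u⁻¹ - r n u) ^ 2‖ ≤ u⁻¹ ^ 2 := by
    intro n u hu
    rw [Real.norm_eq_abs, abs_of_nonneg (sq_nonneg _)]
    exact pow_le_pow_left₀ (sub_nonneg.2 (hr1 n u hu.1)) (by linarith [hr0 n u]) 2
  have hai : ∀ n, Integrable (fun u => (u⁻¹ - r n u) ^ 2) ν := fun n =>
    hint.mono' ((measurable_inv.sub (hr n).measurable).pow_const 2).aestronglyMeasurable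
      (hpos.mono (hb n))
  have ha : Tendsto a atTop (𝓝 0) := by
    have := tendsto_integral_of_dominated_convergence (μ := ν) (fun u : ℝ => u⁻¹ ^ 2)
      (F := fun n u => (u⁻¹ - r n u) ^ 2) (f := fun _ => 0)
      (fun n => (hai n).aestronglyMeasurable) hint (fun n => hpos.mono (hb n))
      (hpos.mono fun u hu => by simpa using ((hrt u hu.1).const_sub u⁻¹).pow 2)
    simpa using this
  have hc : CauchySeq fun n => cfc (r n) B x := by
    refine cauchySeq_of_norm_sub_sq_le (a := fun n => 2 * a n) (by simpa using ha.const_mul 2)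
      fun n m => ?_
    have : cfc (r n) B x - cfc (r m) B x = cfc (fun u => r n u - r m u) B x := by
      rw [cfc_sub (r n) (r m) B (hr n).continuousOn (hr m).continuousOn]
      rfl
    rw [this, norm_cfc_apply_sq hB x (g := fun u => r n u - r m u) ((hr n).sub (hr m)),
      ← integral_const_mul, ← integral_const_mul, ← integral_add ((hai n).const_mul 2) ((hai m).const_mul 2)]
    refine integral_mono (integrable_boundedSpectralMeasure hB x (((hr n).sub (hr m)).pow 2))
      (((hai n).const_mul 2).add ((hai m).const_mul 2)) fun u => ?_
    simp only
    nlinarith [sq_nonneg (u⁻¹ - r n u + (u⁻¹ - r m u))]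
  obtain ⟨y, hy⟩ := cauchySeq_tendsto_of_complete hc
  refine ⟨y, tendsto_nhds_unique ((B.continuous.tendsto y).comp hy) ?_⟩
  rw [tendsto_iff_norm_sub_tendsto_zero]
  have h2 : ∀ n, ‖B (cfc (r n) B x) - x‖ ^ 2 ≤ a n := by
    intro n
    have : B (cfc (r n) B x) - x = cfc (fun u => u * r n u - 1) B x := by
      rw [cfc_sub (fun u => u * r n u) (fun _ => 1) B (continuous_id.mul (hr n)).continuousOn
        continuousOn_const, cfc_mul (fun u => u) (r n) B continuousOn_id (hr n).continuousOn,
        cfc_id' ℝ B, cfc_const_one ℝ B]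
      rfl
    have hcont : Continuous fun u => u * r n u - 1 :=
      (continuous_id.mul (hr n)).sub continuous_const
    rw [this, norm_cfc_apply_sq hB x hcont]
    refine integral_mono_ae (integrable_boundedSpectralMeasure hB x (hcont.pow 2)) (hai n) ?_
    filter_upwards [hpos] with u hu
    have h3 : u * r n u - 1 = -(u * (u⁻¹ - r n u)) := by
      have := hu.1.ne'
      field_simp
      ring
    simp only [h3]
    rw [neg_sq, mul_pow]
    exact mul_le_of_le_one_left (sq_nonneg _) (pow_le_one₀ hu.1.le hu.2)
  have h4 : Tendsto (fun n => ‖B (cfc (r n) B x) - x‖ ^ 2) atTop (𝓝 0) :=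
    squeeze_zero (fun n => sq_nonneg _) h2 ha
  simpa using h4.sqrt

lemma spectralMeasure_eq_resolventMeasure (hs : spectrum ℝ B ⊆ Icc 0 1)
    (hi : ∀ x, B x = 0 → x = 0) {e : ResolutionOfIdentity H}
    (he : ∀ t, e.proj t = resolventProj B t) (x : H) : e.spectralMeasure x = resolventMeasure hB x :=
  e.spectralMeasure_eq fun t => by rw [resolventMeasure_Iic hB hs hi, he]

/-- The spectral theorem for the operator `A = B⁻¹ - 1`. -/
theorem isResolutionOf_resolventResolution {B : H →L[ℂ] H} (hB : IsSelfAdjoint B)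
    (hs : spectrum ℝ B ⊆ Icc 0 1)
    (hi : ∀ x, B x = 0 → x = 0) {A : H →ₗ.[ℂ] H} (hA : ∀ x z, (x, z) ∈ A.graph ↔ B (x + z) = x) :
    (resolventResolution hB hs hi).IsResolutionOf A := by
  have hm := spectralMeasure_eq_resolventMeasure hB hs hi
    (e := resolventResolution hB hs hi) fun t => rfl
  constructor
  · intro x
    rw [hm, mem_domain_iff_exists_resolvent hA]
    constructor
    · rintro ⟨y, rfl⟩
      exact integrable_sq_resolventMeasure hB hs hi y
    · exact exists_apply_eq_of_integrable hB hs hi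
  · intro x
    have h1 := (hA _ _).1 (A.mem_graph x)
    set y := (x : H) + A x with hy
    have h2 : A x = y - x := by rw [hy]; abel
    rw [hm, h2, ← h1, integral_resolventMeasure hB hs hi]
    exact Complex.ext (by simp) (by simpa using im_inner_apply_sub_apply hB y)

end

end UnboundedSpectral

/-! ### Uniqueness of the spectral resolution -/

section Uniqueness

open MeasureTheory Filter Topology Set
open scoped ComplexInnerProductSpace

variable {H : Type*} [NormedAddCommGroup H] [InnerProductSpace ℂ H] [CompleteSpace H]

namespace ResolutionOfIdentity

variable (e : ResolutionOfIdentity H)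

lemma spectralMeasure_real_Iic (x : H) (t : ℝ) :
    (e.spectralMeasure x).real (Iic t) = ‖e.proj t x‖ ^ 2 := by
  rw [measureReal_def, spectralMeasure_Iic, ENNReal.toReal_ofReal (sq_nonneg _)]

lemma proj_proj_of_le {s t : ℝ} (h : s ≤ t) (x : H) : e.proj s (e.proj t x) = e.proj s x :=
  congrArg (fun T : H →L[ℂ] H => T x) (e.monotone s t h)

lemma proj_proj_of_ge {s t : ℝ} (h : s ≤ t) (x : H) : e.proj t (e.proj s x) = e.proj s x := by
  have := congrArg star (e.monotone s t h)
  rw [star_mul, (e.isStarProjection s).isSelfAdjoint.star_eq,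
    (e.isStarProjection t).isSelfAdjoint.star_eq] at this
  exact congrArg (fun T : H →L[ℂ] H => T x) this

lemma norm_proj_sub_sq {s t : ℝ} (h : s ≤ t) (x : H) :
    ‖e.proj t x - e.proj s x‖ ^ 2 = ‖e.proj t x‖ ^ 2 - ‖e.proj s x‖ ^ 2 :=
  (e.isStarProjection s).norm_sub_sq (e.isStarProjection t) (e.monotone s t h) x

lemma spectralMeasure_proj (x : H) (t : ℝ) :
    e.spectralMeasure (e.proj t x) = (e.spectralMeasure x).restrict (Iic t) := by
  refine e.spectralMeasure_eq fun s => ?_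
  rw [measureReal_restrict_apply measurableSet_Iic, Iic_inter_Iic, spectralMeasure_real_Iic]
  rcases le_total s t with h | h
  · rw [inf_eq_left.2 h, e.proj_proj_of_le h]
  · rw [inf_eq_right.2 h, e.proj_proj_of_ge h]

lemma spectralMeasure_sub_proj (x : H) (t : ℝ) :
    e.spectralMeasure (x - e.proj t x) = (e.spectralMeasure x).restrict (Ioi t) := by
  refine e.spectralMeasure_eq fun s => ?_
  rw [measureReal_restrict_apply measurableSet_Iic, map_sub]
  rcases le_total s t with h | h
  · rw [e.proj_proj_of_le h, sub_self, Iic_inter_Ioi, Ioc_eq_empty (not_lt.2 h)]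
    simp
  · rw [e.proj_proj_of_ge h, e.norm_proj_sub_sq h, Iic_inter_Ioi, ← spectralMeasure_real_Iic,
      ← spectralMeasure_real_Iic, ← Iic_union_Ioc_eq_Iic h,
      measureReal_union (Iic_disjoint_Ioc le_rfl) measurableSet_Ioc, add_sub_cancel_left]

lemma spectralMeasure_univ (x : H) : (e.spectralMeasure x).real univ = ‖x‖ ^ 2 := by
  refine tendsto_nhds_unique (tendsto_measureReal_Iic_atTop _) ?_
  simp_rw [spectralMeasure_real_Iic]
  exact (e.tendsto_atTop x).norm.pow 2

variable {e}

lemma spectralMeasure_eq_restrict_Iic {x : H} {t : ℝ} (hx : e.proj t x = x) :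
    e.spectralMeasure x = (e.spectralMeasure x).restrict (Iic t) := by
  rw [← spectralMeasure_proj, hx]

lemma spectralMeasure_eq_restrict_Ioi {x : H} {t : ℝ} (hx : e.proj t x = 0) :
    e.spectralMeasure x = (e.spectralMeasure x).restrict (Ioi t) := by
  rw [← spectralMeasure_sub_proj, hx, sub_zero]

/-- The two measures are the restrictions to `Iic t` and `Ioi t`. The absence of cross terms makes
the form of `A` split along spectral subspaces. -/
lemma spectralMeasure_add {x y : H} {t : ℝ} (hx : e.proj t x = x) (hy : e.proj t y = 0) :
    e.spectralMeasure (x + y) = e.spectralMeasure x + e.spectralMeasure y := by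
  have h : e.proj t (x + y) = x := by rw [map_add, hx, hy, add_zero]
  have h1 := e.spectralMeasure_proj (x + y) t
  have h2 := e.spectralMeasure_sub_proj (x + y) t
  rw [h] at h1 h2
  rw [add_sub_cancel_left] at h2
  rw [h1, h2, ← compl_Iic, Measure.restrict_add_restrict_compl measurableSet_Iic]

lemma proj_proj (t : ℝ) (x : H) : e.proj t (e.proj t x) = e.proj t x := e.proj_proj_of_le le_rfl x

lemma proj_sub_proj (t : ℝ) (x : H) : e.proj t (x - e.proj t x) = 0 := by
  rw [map_sub, proj_proj, sub_self]

namespace IsResolutionOf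

variable {A : H →ₗ.[ℂ] H}

lemma integrable_sq (he : e.IsResolutionOf A) {x z : H} (h : (x, z) ∈ A.graph) :
    Integrable (fun t : ℝ => t ^ 2) (e.spectralMeasure x) :=
  (he.1 x).1 (LinearPMap.mem_domain_of_mem_graph h)

lemma integrable_id (he : e.IsResolutionOf A) {x z : H} (h : (x, z) ∈ A.graph) :
    Integrable (fun t : ℝ => t) (e.spectralMeasure x) := by
  refine ((he.integrable_sq h).add (integrable_const 1)).mono' (by fun_prop)
    (ae_of_all _ fun t => ?_)
  simp only [Pi.add_apply, Real.norm_eq_abs]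
  nlinarith [sq_nonneg (|t| - 1), sq_abs t, abs_nonneg t]

lemma inner_eq (he : e.IsResolutionOf A) {x z : H} (h : (x, z) ∈ A.graph) :
    ⟪x, z⟫ = ((∫ t, t ∂(e.spectralMeasure x) : ℝ) : ℂ) := by
  obtain ⟨⟨a, ha⟩, h1, h2⟩ := (LinearPMap.mem_graph_iff _).1 h
  obtain rfl : a = x := h1
  rw [← he.2 ⟨a, ha⟩, h2]

lemma exists_proj_mem_graph (he : e.IsResolutionOf A) {x z : H} (h : (x, z) ∈ A.graph) (t : ℝ) :
    ∃ w, (e.proj t x, w) ∈ A.graph := by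
  have h1 : e.proj t x ∈ A.domain := by
    rw [he.1, spectralMeasure_proj]
    exact (he.integrable_sq h).restrict
  exact ⟨_, A.mem_graph ⟨_, h1⟩⟩

/-- Vectors in complementary spectral subspaces are orthogonal with respect to the form of `A`. -/
lemma inner_eq_zero (he : e.IsResolutionOf A) {x z y w : H} {t : ℝ} (h : (x, z) ∈ A.graph)
    (h' : (y, w) ∈ A.graph) (hx : e.proj t x = x) (hy : e.proj t y = 0) :
    ⟪x, w⟫ = 0 ∧ ⟪y, z⟫ = 0 := by
  -- Expanding the form at `x + y` makes the sum of the cross terms vanish; replacing `x` by `I x`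
  -- does the same for their difference.
  have key : ∀ x z : H, (x, z) ∈ A.graph → e.proj t x = x → ⟪x, w⟫ + ⟪y, z⟫ = 0 := by
    intro x z h hx
    have h1 := he.inner_eq (A.graph.add_mem h h')
    change ⟪x + y, z + w⟫ = ((∫ t, t ∂(e.spectralMeasure (x + y)) : ℝ) : ℂ) at h1
    rw [spectralMeasure_add hx hy, integral_add_measure (he.integrable_id h)
      (he.integrable_id h'), Complex.ofReal_add, ← he.inner_eq h, ← he.inner_eq h',
      inner_add_left, inner_add_right, inner_add_right] at h1
    linear_combination h1
  have h1 := key x z h hx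
  have h2 := key (Complex.I • x) (Complex.I • z) (A.graph.smul_mem Complex.I h)
    (by rw [map_smul, hx])
  rw [inner_smul_left, inner_smul_right, Complex.conj_I] at h2
  have h3 : Complex.I * (⟪y, z⟫ - ⟪x, w⟫) = 0 := by linear_combination h2
  have h4 := (mul_eq_zero.1 h3).resolve_left Complex.I_ne_zero
  constructor
  · linear_combination (h1 - h4) / 2
  · linear_combination (h1 + h4) / 2

/-- The spectral projections commute with the operator. -/
lemma proj_mem_graph (he : e.IsResolutionOf A) (hd : Dense (A.domain : Set H)) {x z : H}
    (h : (x, z) ∈ A.graph) (t : ℝ) : (e.proj t x, e.proj t z) ∈ A.graph := by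
  obtain ⟨w, hw⟩ := he.exists_proj_mem_graph h t
  have hsub := A.graph.sub_mem h hw
  have hsa := (e.isStarProjection t).isSelfAdjoint
  -- Here `w = A e_t x`. Testing against the dense domain shows that `e_t` fixes `w` and annihilates
  -- `z - w = A (x - e_t x)`.
  have h1 : w - e.proj t w = 0 := by
    refine hd.eq_zero_of_inner_right ℂ fun v hv => ?_
    obtain ⟨w', hw'⟩ := he.exists_proj_mem_graph (A.mem_graph ⟨v, hv⟩) t
    have := (he.inner_eq_zero hw (A.graph.sub_mem (A.mem_graph ⟨v, hv⟩) hw')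
      (proj_proj t x) (proj_sub_proj t v)).2
    rw [inner_sub_right, ← hsa.inner_apply_left, ← inner_sub_left]
    exact this
  have h2 : e.proj t (z - w) = 0 := by
    refine hd.eq_zero_of_inner_right ℂ fun v hv => ?_
    obtain ⟨w', hw'⟩ := he.exists_proj_mem_graph (A.mem_graph ⟨v, hv⟩) t
    have := (he.inner_eq_zero hw' hsub (proj_proj t v) (proj_sub_proj t x)).1
    rw [← hsa.inner_apply_left]
    exact this
  have h3 : w = e.proj t z := by
    rw [map_sub] at h2
    rw [sub_eq_zero.1 h1, sub_eq_zero.1 h2]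
  rwa [← h3]

end IsResolutionOf

end ResolutionOfIdentity

section

open ResolutionOfIdentity

variable {B : H →L[ℂ] H}

lemma dense_range_of_injective (hB : IsSelfAdjoint B) (hi : ∀ x, B x = 0 → x = 0) :
    Dense (range B) := by
  intro x
  have h := sub_kerProj_mem_closure_range hB x
  rwa [hi _ (apply_kerProj B x), sub_zero] at h

variable {A : H →ₗ.[ℂ] H} {e : ResolutionOfIdentity H}

lemma ResolutionOfIdentity.IsResolutionOf.commute_resolvent (he : e.IsResolutionOf A)
    (hB : IsSelfAdjoint B) (hi : ∀ x, B x = 0 → x = 0)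
    (hA : ∀ x z, (x, z) ∈ A.graph ↔ B (x + z) = x) (t : ℝ) : Commute B (e.proj t) := by
  have hd : Dense (A.domain : Set H) := by
    convert dense_range_of_injective hB hi using 1
    ext x
    exact mem_domain_iff_exists_resolvent hA x
  refine ContinuousLinearMap.ext fun y => ?_
  have h := he.proj_mem_graph hd ((hA (B y) (y - B y)).2 (by rw [add_sub_cancel])) t
  rw [hA, ← map_add, add_sub_cancel] at h
  exact h

/-- The function whose integrals are the values of the quadratic form of `B (A - t) B`. -/
lemma integral_resolvent_form (he : e.IsResolutionOf A) (hB : IsSelfAdjoint B)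
    (hA : ∀ x z, (x, z) ∈ A.graph ↔ B (x + z) = x) (t : ℝ) (y : H) :
    Integrable (fun s => s - t) (e.spectralMeasure (B y)) ∧
    ∫ s, (s - t) ∂(e.spectralMeasure (B y)) =
      ∫ u, u * (1 - (1 + t) * u) ∂(boundedSpectralMeasure hB y) := by
  have hg : (B y, y - B y) ∈ A.graph := (hA _ _).2 (by rw [add_sub_cancel])
  refine ⟨(he.integrable_id hg).sub (integrable_const t), ?_⟩
  have h1 := congrArg Complex.re (he.inner_eq hg)
  rw [Complex.ofReal_re, re_inner_apply_sub_apply hB] at h1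
  have h2 := norm_cfc_apply_sq hB y (g := fun u => u) continuous_id
  rw [cfc_id' ℝ B] at h2
  rw [integral_sub (he.integrable_id hg) (integrable_const t), ← h1, integral_const,
    e.spectralMeasure_univ, h2, smul_eq_mul, ← integral_mul_const,
    ← integral_sub (integrable_boundedSpectralMeasure hB y (by fun_prop))
      (integrable_boundedSpectralMeasure hB y (by fun_prop))]
  congr 1
  ext u
  ring

/-- Let `φ` be the threshold function and `y = φ(B) x`. The form of `A - t` at `B y` is at most
zero, as `B y` lies in the range of `e_t`, but it equals `∫ u φ(u)³ ≥ 0` for the spectral measure of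
`x`. Hence `φ = 0` almost everywhere. -/
lemma resolventThreshold_apply_eq_zero (he : e.IsResolutionOf A) (hB : IsSelfAdjoint B)
    (hs : spectrum ℝ B ⊆ Icc 0 1) (hi : ∀ x, B x = 0 → x = 0)
    (hA : ∀ x z, (x, z) ∈ A.graph ↔ B (x + z) = x) {t : ℝ} {x : H} (hx : e.proj t x = x) :
    cfc (resolventThreshold t) B x = 0 := by
  have hc := continuous_resolventThreshold t
  have hcomm := he.commute_resolvent hB hi hA t
  set y := cfc (resolventThreshold t) B x with hy
  have hy1 : e.proj t y = y := by
    have := congrArg (fun T : H →L[ℂ] H => T x) (hcomm.cfc_real (resolventThreshold t)).eq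
    change cfc (resolventThreshold t) B (e.proj t x) = e.proj t (cfc (resolventThreshold t) B x)
      at this
    rw [hx] at this
    exact this.symm
  have hBy : e.proj t (B y) = B y := by
    have := congrArg (fun T : H →L[ℂ] H => T y) hcomm.eq
    change B (e.proj t y) = e.proj t (B y) at this
    rw [← this, hy1]
  have h1 : ∫ s, (s - t) ∂(e.spectralMeasure (B y)) ≤ 0 := by
    rw [spectralMeasure_eq_restrict_Iic hBy]
    exact setIntegral_nonpos measurableSet_Iic fun s hs' => sub_nonpos.2 hs'
  rw [(integral_resolvent_form he hB hA t y).2, hy, boundedSpectralMeasure_cfc_apply hB x hc,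
    integral_withDensity_eq_integral_toReal_smul (by fun_prop) (by simp)] at h1
  have hpos := ae_pos_boundedSpectralMeasure hB hs hi x
  have h2 : ∀ u, (ENNReal.ofReal (resolventThreshold t u ^ 2)).toReal •
      (u * (1 - (1 + t) * u)) = u * resolventThreshold t u ^ 3 := by
    intro u
    rw [ENNReal.toReal_ofReal (sq_nonneg _), smul_eq_mul]
    by_cases h : 0 ≤ 1 - (1 + t) * u
    · rw [resolventThreshold, max_eq_right h]
      ring
    · rw [resolventThreshold, max_eq_left (not_le.1 h).le]
      ring
  simp_rw [h2] at h1
  have hnn : 0 ≤ᵐ[boundedSpectralMeasure hB x] fun u => u * resolventThreshold t u ^ 3 :=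
    hpos.mono fun u hu => mul_nonneg hu.1.le (pow_nonneg (resolventThreshold_nonneg _ _) 3)
  have h3 := (integral_eq_zero_iff_of_nonneg_ae hnn
    (integrable_boundedSpectralMeasure hB x (by fun_prop))).1
    (le_antisymm h1 (integral_nonneg_of_ae hnn))
  have h4 := norm_cfc_apply_sq hB x hc
  rw [integral_eq_zero_of_ae] at h4
  · exact norm_eq_zero.1 (pow_eq_zero_iff two_ne_zero |>.1 h4)
  · filter_upwards [h3, hpos] with u h5 h6
    have := (mul_eq_zero.1 h5).resolve_left h6.1.ne'
    simp only [pow_eq_zero_iff three_ne_zero |>.1 this, Pi.zero_apply]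
    norm_num

/-- For `y = x - e_t x` the threshold function of `B` annihilates `y`, so the form of `A - t` at `B
y` is at most zero. But the measure of `B y` lives on `(t, ∞)`, where `s - t > 0`. So this measure
vanishes, and with it `B y` and `y`. -/
lemma proj_eq_self_of_resolventThreshold (he : e.IsResolutionOf A) (hB : IsSelfAdjoint B)
    (hs : spectrum ℝ B ⊆ Icc 0 1) (hi : ∀ x, B x = 0 → x = 0)
    (hA : ∀ x z, (x, z) ∈ A.graph ↔ B (x + z) = x) {t : ℝ} {x : H}
    (hx : cfc (resolventThreshold t) B x = 0) : e.proj t x = x := by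
  have hc := continuous_resolventThreshold t
  have hcomm := he.commute_resolvent hB hi hA t
  set y := x - e.proj t x with hy
  have hy1 : cfc (resolventThreshold t) B y = 0 := by
    have := congrArg (fun T : H →L[ℂ] H => T x) (hcomm.cfc_real (resolventThreshold t)).eq
    change cfc (resolventThreshold t) B (e.proj t x) = e.proj t (cfc (resolventThreshold t) B x)
      at this
    rw [hy, map_sub, this, hx, map_zero, sub_zero]
  have hBy : e.proj t (B y) = 0 := by
    have := congrArg (fun T : H →L[ℂ] H => T y) hcomm.eq
    change B (e.proj t y) = e.proj t (B y) at this
    rw [← this, hy, proj_sub_proj, map_zero]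
  obtain ⟨hint, hform⟩ := integral_resolvent_form he hB hA t y
  have h1 : ∫ u, u * (1 - (1 + t) * u) ∂(boundedSpectralMeasure hB y) ≤ 0 := by
    have h2 := norm_cfc_apply_sq hB y hc
    rw [hy1, norm_zero, zero_pow two_ne_zero, eq_comm, integral_eq_zero_iff_of_nonneg
      (fun u => sq_nonneg _) (integrable_boundedSpectralMeasure hB y (hc.pow 2))] at h2
    refine integral_nonpos_of_ae ?_
    filter_upwards [h2, ae_pos_boundedSpectralMeasure hB hs hi y] with u h3 h4
    have h5 : resolventThreshold t u = 0 := by simpa using h3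
    rw [resolventThreshold_eq_zero_iff] at h5
    exact mul_nonpos_of_nonneg_of_nonpos h4.1.le (by linarith)
  rw [← hform] at h1
  have hr := spectralMeasure_eq_restrict_Ioi hBy
  have hae : ∀ᵐ s ∂(e.spectralMeasure (B y)), s ∈ Ioi t := by
    rw [hr]
    exact ae_restrict_mem measurableSet_Ioi
  have hnn : 0 ≤ᵐ[e.spectralMeasure (B y)] fun s => s - t :=
    hae.mono fun s hs' => sub_nonneg.2 (le_of_lt hs')
  have h6 := (integral_eq_zero_iff_of_nonneg_ae hnn hint).1
    (le_antisymm h1 (integral_nonneg_of_ae hnn))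
  have h7 : e.spectralMeasure (B y) = 0 := by
    rw [← ae_eq_bot, ← eventually_false_iff_eq_bot]
    filter_upwards [h6, hae] with s h8 h9
    exact (sub_pos.2 h9).ne' h8
  have h8 := e.spectralMeasure_univ (B y)
  rw [h7, measureReal_zero_apply] at h8
  have h9 := hi y (norm_eq_zero.1 (pow_eq_zero_iff two_ne_zero |>.1 h8.symm))
  exact (sub_eq_zero.1 h9).symm

/-- Uniqueness of the spectral resolution of `A = B⁻¹ - 1`. -/
theorem ResolutionOfIdentity.IsResolutionOf.proj_eq_resolventProj (he : e.IsResolutionOf A)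
    (hB : IsSelfAdjoint B) (hs : spectrum ℝ B ⊆ Icc 0 1) (hi : ∀ x, B x = 0 → x = 0)
    (hA : ∀ x z, (x, z) ∈ A.graph ↔ B (x + z) = x) (t : ℝ) : e.proj t = resolventProj B t := by
  have h1 : resolventProj B t * e.proj t = e.proj t := ContinuousLinearMap.ext fun x =>
    kerProj_eq_self _ (resolventThreshold_apply_eq_zero he hB hs hi hA (proj_proj t x))
  have h2 : e.proj t * resolventProj B t = resolventProj B t := ContinuousLinearMap.ext fun x =>
    proj_eq_self_of_resolventThreshold he hB hs hi hA (apply_kerProj _ x)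
  have h3 := congrArg star h1
  rw [star_mul, (e.isStarProjection t).isSelfAdjoint.star_eq,
    show star (resolventProj B t) = resolventProj B t from
      (isStarProjection_kerProj _).isSelfAdjoint.star_eq] at h3
  rw [← h3, h2]

end

end Uniqueness

/-! ### Rényi integrals of inversion symmetric measures -/

section Analysis

open MeasureTheory Filter Topology Set
open StandardSubspace (renyiIntegrand)

lemma extIntegral_of_integrable {μ : Measure ℝ} {g : ℝ → ℝ} (hg : Integrable g μ) :
    extIntegral μ g = ((∫ t, g t ∂μ : ℝ) : EReal) := by
  have h1 : ∫⁻ t, ENNReal.ofReal (g t) ∂μ ≠ ⊤ := hg.lintegral_lt_top.ne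
  have h2 : ∫⁻ t, ENNReal.ofReal (-g t) ∂μ ≠ ⊤ := hg.neg.lintegral_lt_top.ne
  rw [extIntegral, integral_eq_lintegral_pos_part_sub_lintegral_neg_part hg, EReal.coe_sub,
    EReal.coe_ennreal_toReal h1, EReal.coe_ennreal_toReal h2]

/-- Adding an integrable function with integral zero does not change the extended integral. -/
lemma extIntegral_eq_lintegral {μ : Measure ℝ} {g ψ k : ℝ → ℝ} (hψ : Measurable ψ)
    (h0 : 0 ≤ᵐ[μ] ψ) (hk : Integrable k μ) (hk0 : ∫ t, k t ∂μ = 0) (hg : ∀ t, g t = ψ t + k t) :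
    extIntegral μ g = ((∫⁻ t, ENNReal.ofReal (ψ t) ∂μ : ENNReal) : EReal) := by
  obtain rfl : g = fun t => ψ t + k t := funext hg
  -- No `∞ - ∞` occurs: `ψ ≤ g⁺ + k⁻` makes the positive part of `g` infinite, while its negative
  -- part is at most the integrable `k⁻`.
  by_cases hfin : ∫⁻ t, ENNReal.ofReal (ψ t) ∂μ = ⊤
  · have h1 : ∫⁻ t, ENNReal.ofReal (ψ t + k t) ∂μ = ⊤ := by
      by_contra hne
      have h2 : ∫⁻ t, ENNReal.ofReal (ψ t) ∂μ ≤
          ∫⁻ t, ENNReal.ofReal (ψ t + k t) ∂μ + ∫⁻ t, ENNReal.ofReal (-k t) ∂μ := by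
        rw [← lintegral_add_right' (g := fun t => ENNReal.ofReal (-k t)) _
          hk.neg.aemeasurable.ennreal_ofReal]
        refine lintegral_mono fun t => ?_
        calc ENNReal.ofReal (ψ t) = ENNReal.ofReal (ψ t + k t + -k t) := by ring_nf
          _ ≤ _ := ENNReal.ofReal_add_le
      rw [hfin, top_le_iff, ENNReal.add_eq_top] at h2
      exact h2.elim hne hk.neg.lintegral_lt_top.ne
    have h3 : ∫⁻ t, ENNReal.ofReal (-(ψ t + k t)) ∂μ ≠ ⊤ := by
      refine ne_top_of_le_ne_top hk.neg.lintegral_lt_top.ne (lintegral_mono_ae ?_)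
      filter_upwards [h0] with t ht
      refine ENNReal.ofReal_le_ofReal ?_
      simp only [Pi.zero_apply, Pi.neg_apply] at ht ⊢
      linarith
    rw [extIntegral, h1, hfin, ← EReal.coe_ennreal_toReal h3, EReal.coe_ennreal_top,
      EReal.top_sub_coe]
  · have hi : Integrable ψ μ :=
      ⟨hψ.aestronglyMeasurable, by rwa [hasFiniteIntegral_iff_ofReal h0, lt_top_iff_ne_top]⟩
    rw [extIntegral_of_integrable (g := fun t => ψ t + k t) (hi.add hk), integral_add hi hk, hk0,
      add_zero,
      integral_eq_lintegral_of_nonneg_ae h0 hψ.aestronglyMeasurable, EReal.coe_ennreal_toReal hfin]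

lemma renyiIntegrand_one (t : ℝ) : renyiIntegrand 1 t = -Real.log t := if_pos rfl

lemma renyiIntegrand_of_ne {α : ℝ} (h : α ≠ 1) (t : ℝ) :
    renyiIntegrand α t = (t ^ (1 - α) - 1) / (α - 1) := if_neg h

lemma renyiIntegrand_zero (t : ℝ) : renyiIntegrand 0 t = 1 - t := by
  rw [renyiIntegrand_of_ne zero_ne_one]
  rw [sub_zero, Real.rpow_one]
  ring

lemma measurable_renyiIntegrand (α : ℝ) : Measurable (renyiIntegrand α) := by
  by_cases h : α = 1
  · subst h
    simp_rw [funext renyiIntegrand_one]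
    exact Real.measurable_log.neg
  · simp_rw [funext (renyiIntegrand_of_ne h)]
    fun_prop

/-- Up to sign this is `(t ^ p - 1) / p` with `p = 1 - α`. It grows with `p` by Bernoulli's
inequality for the exponent `(1 - β) / (1 - α) ≤ 1`; for `β = 1` the inequality is `1 + x ≤ exp x`.
-/
lemma renyiIntegrand_mono {t : ℝ} (ht : 0 < t) {α β : ℝ} (h : α ≤ β) (hβ : β ≤ 1) :
    renyiIntegrand α t ≤ renyiIntegrand β t := by
  rcases hβ.eq_or_lt with rfl | hβ
  · rcases h.eq_or_lt with rfl | hα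
    · rfl
    · rw [renyiIntegrand_one, renyiIntegrand_of_ne hα.ne,
        div_le_iff_of_neg (sub_neg.2 hα), Real.rpow_def_of_pos ht]
      have := Real.add_one_le_exp (Real.log t * (1 - α))
      linarith
  · have hα : α < 1 := h.trans_lt hβ
    rw [renyiIntegrand_of_ne hα.ne, renyiIntegrand_of_ne hβ.ne]
    have h1 : 0 < 1 - α := sub_pos.2 hα
    have h2 : 0 < 1 - β := sub_pos.2 hβ
    have h3 := rpow_one_add_le_one_add_mul_self (s := t ^ (1 - α) - 1)
      (by linarith [Real.rpow_pos_of_pos ht (1 - α)]) (p := (1 - β) / (1 - α)) (by positivity)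
      ((div_le_one h1).2 (by linarith))
    rw [add_sub_cancel, ← Real.rpow_mul ht.le, mul_div_cancel₀ _ h1.ne'] at h3
    have h4 : (t ^ (1 - β) - 1) / (1 - β) ≤ (t ^ (1 - α) - 1) / (1 - α) := by
      rw [div_le_iff₀ h2]
      calc t ^ (1 - β) - 1 ≤ (1 - β) / (1 - α) * (t ^ (1 - α) - 1) := by linarith
        _ = _ := by ring
    have h5 : ∀ γ : ℝ, (t ^ (1 - γ) - 1) / (γ - 1) = -((t ^ (1 - γ) - 1) / (1 - γ)) := fun γ => by
      rw [← div_neg, neg_sub]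
    rw [h5, h5]
    exact neg_le_neg h4

/-- At `α = 1` the integrand is the slope of `β ↦ t ^ (1 - β)`, whose derivative there is `-log t`.
-/
lemma tendsto_renyiIntegrand {t : ℝ} (ht : 0 < t) (α : ℝ) :
    Tendsto (fun β => renyiIntegrand β t) (𝓝 α) (𝓝 (renyiIntegrand α t)) := by
  by_cases h : α = 1
  · subst h
    have h1 : HasDerivAt (fun β : ℝ => t ^ (1 - β)) (-Real.log t) 1 := by
      have h2 := (Real.hasStrictDerivAt_const_rpow ht (1 - 1)).hasDerivAt.comp_const_sub (1 : ℝ) 1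
      rwa [sub_self, Real.rpow_zero, one_mul] at h2
    rw [hasDerivAt_iff_tendsto_slope] at h1
    refine continuousWithinAt_compl_self.1 ?_
    rw [ContinuousWithinAt, renyiIntegrand_one]
    refine h1.congr' ?_
    filter_upwards [self_mem_nhdsWithin] with β hβ
    rw [slope_def_field, renyiIntegrand_of_ne hβ, sub_self, Real.rpow_zero]
  · have h1 : ContinuousAt (fun β : ℝ => (t ^ (1 - β) - 1) / (β - 1)) α := by
      refine ContinuousAt.div ?_ (by fun_prop) (sub_ne_zero.2 h)
      exact (ContinuousAt.rpow continuousAt_const (by fun_prop) (Or.inl ht.ne')).sub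
        continuousAt_const
    rw [renyiIntegrand_of_ne h]
    refine h1.tendsto.congr' ?_
    filter_upwards [isOpen_ne.mem_nhds h] with β hβ
    rw [renyiIntegrand_of_ne hβ]

/-- A measure on `(0, ∞)` with `t dm(t) = dm(1 / t)`. -/
structure IsInversionSymmetric (m : Measure ℝ) : Prop where
  ae_pos : ∀ᵐ t ∂m, 0 < t
  lintegral_inv : ∀ h : ℝ → ENNReal, Measurable h →
    ∫⁻ t, ENNReal.ofReal t * h t ∂m = ∫⁻ t, h t⁻¹ ∂m

namespace IsInversionSymmetric

variable {m : Measure ℝ}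

lemma restrict_Ioi (hm : IsInversionSymmetric m) : m.restrict (Ioi 0) = m :=
  Measure.restrict_eq_self_of_ae_mem hm.ae_pos

lemma lintegral_id (hm : IsInversionSymmetric m) : ∫⁻ t, ENNReal.ofReal t ∂m = m univ := by
  simpa using hm.lintegral_inv (fun _ => 1) measurable_const

lemma lintegral_mono_renyi (hm : IsInversionSymmetric m) {α β : ℝ} (h : α ≤ β) (hβ : β ≤ 1) :
    ∫⁻ t, ENNReal.ofReal (renyiIntegrand α t - (1 - t)) ∂m ≤
      ∫⁻ t, ENNReal.ofReal (renyiIntegrand β t - (1 - t)) ∂m := by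
  refine lintegral_mono_ae (hm.ae_pos.mono fun t ht => ENNReal.ofReal_le_ofReal ?_)
  linarith [renyiIntegrand_mono ht h hβ]

/-- The symmetry with test function `t ^ (-p)`. The computation in `[0, ∞]` covers divergent
integrals, where both sides are `0`. -/
lemma integral_rpow_one_sub (hm : IsInversionSymmetric m) (p : ℝ) :
    ∫ t, t ^ (1 - p) ∂m = ∫ t, t ^ p ∂m := by
  have hnn : ∀ q : ℝ, 0 ≤ᵐ[m] fun t => t ^ q := fun q =>
    hm.ae_pos.mono fun t ht => Real.rpow_nonneg ht.le q
  rw [integral_eq_lintegral_of_nonneg_ae (hnn _) (by fun_prop),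
    integral_eq_lintegral_of_nonneg_ae (hnn _) (by fun_prop)]
  congr 1
  have h := hm.lintegral_inv (fun t => ENNReal.ofReal (t ^ (-p))) (by fun_prop)
  calc ∫⁻ t, ENNReal.ofReal (t ^ (1 - p)) ∂m
      = ∫⁻ t, ENNReal.ofReal t * ENNReal.ofReal (t ^ (-p)) ∂m := by
        refine lintegral_congr_ae (hm.ae_pos.mono fun t ht => ?_)
        simp only
        rw [← ENNReal.ofReal_mul ht.le, sub_eq_add_neg, Real.rpow_add ht, Real.rpow_one]
    _ = ∫⁻ t, ENNReal.ofReal (t ^ p) ∂m := by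
        rw [h]
        refine lintegral_congr_ae (hm.ae_pos.mono fun t ht => ?_)
        simp only
        rw [Real.inv_rpow ht.le, ← Real.rpow_neg ht.le, neg_neg]

lemma integral_id (hm : IsInversionSymmetric m) : ∫ t, t ∂m = m.real univ := by
  rw [integral_eq_lintegral_of_nonneg_ae (hm.ae_pos.mono fun t ht => ht.le) (by fun_prop),
    hm.lintegral_id, measureReal_def]

/-- Monotone convergence along a sequence increasing to `1`; monotonicity in `β` extends the limit
to all `β ≤ 1`. -/
lemma tendsto_lintegral_one (hm : IsInversionSymmetric m) :
    Tendsto (fun β => ∫⁻ t, ENNReal.ofReal (renyiIntegrand β t - (1 - t)) ∂m) (𝓝[≤] 1)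
      (𝓝 (∫⁻ t, ENNReal.ofReal (renyiIntegrand 1 t - (1 - t)) ∂m)) := by
  obtain ⟨a, ha, ha1, hat⟩ := exists_seq_strictMono_tendsto (1 : ℝ)
  have h := lintegral_tendsto_of_tendsto_of_monotone (μ := m)
    (f := fun n t => ENNReal.ofReal (renyiIntegrand (a n) t - (1 - t)))
    (F := fun t => ENNReal.ofReal (renyiIntegrand 1 t - (1 - t)))
    (fun n => ((measurable_renyiIntegrand _).sub (by fun_prop)).ennreal_ofReal.aemeasurable)
    (hm.ae_pos.mono fun t ht i j hij => ENNReal.ofReal_le_ofReal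
      (by linarith [renyiIntegrand_mono ht (ha.monotone hij) (ha1 j).le]))
    (hm.ae_pos.mono fun t ht => ENNReal.tendsto_ofReal
      (((tendsto_renyiIntegrand ht 1).comp hat).sub_const _))
  refine tendsto_order.2 ⟨fun c hc => ?_, fun c hc => ?_⟩
  · obtain ⟨n, hn⟩ := (h.eventually (lt_mem_nhds hc)).exists
    filter_upwards [self_mem_nhdsWithin, mem_nhdsWithin_of_mem_nhds (lt_mem_nhds (ha1 n))]
      with β hβ hβ'
    exact hn.trans_le (hm.lintegral_mono_renyi (le_of_lt hβ') hβ)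
  · filter_upwards [self_mem_nhdsWithin] with β hβ
    exact (hm.lintegral_mono_renyi hβ le_rfl).trans_lt hc

variable [IsFiniteMeasure m]

lemma integrable_id (hm : IsInversionSymmetric m) : Integrable (fun t : ℝ => t) m := by
  refine ⟨by fun_prop, ?_⟩
  rw [hasFiniteIntegral_iff_ofReal (hm.ae_pos.mono fun t ht => ht.le), hm.lintegral_id]
  exact measure_lt_top m _

lemma integrable_rpow (hm : IsInversionSymmetric m) {p : ℝ} (h0 : 0 ≤ p) (h1 : p ≤ 1) :
    Integrable (fun t : ℝ => t ^ p) m := by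
  refine ((integrable_const 1).add hm.integrable_id).mono' (by fun_prop) ?_
  filter_upwards [hm.ae_pos] with t ht
  rw [Real.norm_of_nonneg (Real.rpow_nonneg ht.le p), Pi.add_apply]
  rcases le_total t 1 with h | h
  · exact (Real.rpow_le_one ht.le h h0).trans (by linarith)
  · calc t ^ p ≤ t ^ (1 : ℝ) := Real.rpow_le_rpow_of_exponent_le h h1
      _ ≤ 1 + t := by rw [Real.rpow_one]; linarith

lemma integrable_renyiIntegrand (hm : IsInversionSymmetric m) {α : ℝ} (hα : α ∈ Ico (0 : ℝ) 1) :
    Integrable (renyiIntegrand α) m := by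
  simp_rw [funext (renyiIntegrand_of_ne hα.2.ne)]
  exact ((hm.integrable_rpow (by linarith [hα.2]) (by linarith [hα.1])).sub
    (integrable_const 1)).div_const _

lemma extIntegral_renyiIntegrand (hm : IsInversionSymmetric m) {α : ℝ} (hα : α ∈ Ico (0 : ℝ) 1) :
    extIntegral m (renyiIntegrand α) =
      (((∫ t, t ^ (1 - α) ∂m - m.real univ) / (α - 1) : ℝ) : EReal) := by
  rw [extIntegral_of_integrable (hm.integrable_renyiIntegrand hα)]
  simp_rw [renyiIntegrand_of_ne hα.2.ne]
  rw [integral_div, integral_sub (hm.integrable_rpow (by linarith [hα.2]) (by linarith [hα.1]))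
    (integrable_const 1)]
  simp

/-- The integral of the non-negative function `renyiIntegrand α t - (1 - t)`. -/
lemma extIntegral_eq (hm : IsInversionSymmetric m) {α : ℝ} (hα : α ∈ Icc (0 : ℝ) 1) :
    extIntegral m (renyiIntegrand α) =
      ((∫⁻ t, ENNReal.ofReal (renyiIntegrand α t - (1 - t)) ∂m : ENNReal) : EReal) := by
  refine extIntegral_eq_lintegral (k := fun t => 1 - t)
    ((measurable_renyiIntegrand α).sub (by fun_prop)) ?_
    ((integrable_const 1).sub hm.integrable_id) ?_ fun t => by ring
  · filter_upwards [hm.ae_pos] with t ht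
    rw [Pi.zero_apply, sub_nonneg, ← renyiIntegrand_zero]
    exact renyiIntegrand_mono ht hα.1 hα.2
  · rw [integral_sub (integrable_const 1) hm.integrable_id, hm.integral_id]
    simp

lemma extIntegral_nonneg (hm : IsInversionSymmetric m) {α : ℝ} (hα : α ∈ Icc (0 : ℝ) 1) :
    0 ≤ extIntegral m (renyiIntegrand α) := by
  rw [hm.extIntegral_eq hα]
  exact EReal.coe_ennreal_nonneg _

lemma extIntegral_zero (hm : IsInversionSymmetric m) : extIntegral m (renyiIntegrand 0) = 0 := by
  rw [hm.extIntegral_eq ⟨le_rfl, zero_le_one⟩]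
  simp [renyiIntegrand_zero]

lemma monotoneOn_extIntegral (hm : IsInversionSymmetric m) :
    MonotoneOn (fun α => extIntegral m (renyiIntegrand α)) (Icc 0 1) := by
  intro α hα β hβ h
  simp only [hm.extIntegral_eq hα, hm.extIntegral_eq hβ]
  exact EReal.coe_ennreal_le_coe_ennreal_iff.2 (hm.lintegral_mono_renyi h hβ.2)

/-- The integrand at the midpoint of `α` and `1` dominates. No lower bound is needed for `β < 0`, as
`ENNReal.ofReal` cuts off negative values. -/
lemma tendsto_lintegral_of_lt_one (hm : IsInversionSymmetric m) {α : ℝ} (hα : α ∈ Ico (0 : ℝ) 1) :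
    Tendsto (fun β => ∫⁻ t, ENNReal.ofReal (renyiIntegrand β t - (1 - t)) ∂m) (𝓝 α)
      (𝓝 (∫⁻ t, ENNReal.ofReal (renyiIntegrand α t - (1 - t)) ∂m)) := by
  have hγ : α < (α + 1) / 2 ∧ (α + 1) / 2 < 1 := ⟨by linarith [hα.2], by linarith [hα.2]⟩
  refine tendsto_lintegral_filter_of_dominated_convergence
    (fun t => ENNReal.ofReal (renyiIntegrand ((α + 1) / 2) t - (1 - t)))
    (Eventually.of_forall fun β => ?_) ?_ ?_ ?_
  · exact ((measurable_renyiIntegrand β).sub (by fun_prop)).ennreal_ofReal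
  · filter_upwards [gt_mem_nhds hγ.1] with β hβ
    filter_upwards [hm.ae_pos] with t ht
    refine ENNReal.ofReal_le_ofReal ?_
    linarith [renyiIntegrand_mono ht hβ.le hγ.2.le]
  · exact ((hm.integrable_renyiIntegrand ⟨by linarith [hα.1], hγ.2⟩).sub
      ((integrable_const 1).sub hm.integrable_id)).lintegral_lt_top.ne
  · filter_upwards [hm.ae_pos] with t ht
    exact ENNReal.tendsto_ofReal ((tendsto_renyiIntegrand ht α).sub_const _)

lemma continuousOn_extIntegral (hm : IsInversionSymmetric m) :
    ContinuousOn (fun α => extIntegral m (renyiIntegrand α)) (Icc 0 1) := by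
  have h : ContinuousOn
      (fun α => ∫⁻ t, ENNReal.ofReal (renyiIntegrand α t - (1 - t)) ∂m) (Icc 0 1) := by
    intro α hα
    rcases hα.2.eq_or_lt with rfl | h1
    · exact hm.tendsto_lintegral_one.mono_left (nhdsWithin_mono _ fun β hβ => hβ.2)
    · exact (hm.tendsto_lintegral_of_lt_one ⟨hα.1, h1⟩).mono_left nhdsWithin_le_nhds
  exact (continuous_coe_ennreal_ereal.comp_continuousOn h).congr fun α hα => hm.extIntegral_eq hα

lemma lintegral_log_lt_top (hm : IsInversionSymmetric m) :
    ∫⁻ t, ENNReal.ofReal (Real.log t) ∂m < ⊤ := by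
  refine lt_of_le_of_lt (lintegral_mono_ae (hm.ae_pos.mono fun t ht => ?_))
    hm.integrable_id.lintegral_lt_top
  exact ENNReal.ofReal_le_ofReal (by linarith [Real.log_le_sub_one_of_pos ht])

open ProbabilityTheory in
-- The integral is the moment generating function of `log`, finite on `[0, 1]` and thus
-- differentiable in the interior.
lemma differentiableAt_integral_rpow (hm : IsInversionSymmetric m) {p : ℝ}
    (hp : p ∈ Ioo (0 : ℝ) 1) : DifferentiableAt ℝ (fun p => ∫ t, t ^ p ∂m) p := by
  have he : ∀ q, mgf Real.log m q = ∫ t, t ^ q ∂m := fun q =>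
    integral_congr_ae (hm.ae_pos.mono fun t ht => by
      simp only [Real.rpow_def_of_pos ht, mul_comm])
  simp_rw [← he]
  refine differentiableAt_mgf (mem_interior_iff_mem_nhds.2 ?_)
  filter_upwards [Ioo_mem_nhds hp.1 hp.2] with q hq
  refine (hm.integrable_rpow hq.1.le hq.2.le).congr (hm.ae_pos.mono fun t ht => ?_)
  simp only [Real.rpow_def_of_pos ht, mul_comm]

lemma differentiableAt_extIntegral (hm : IsInversionSymmetric m) {α : ℝ}
    (hα : α ∈ Ioo (0 : ℝ) 1) :
    DifferentiableAt ℝ (fun β => (extIntegral m (renyiIntegrand β)).toReal) α := by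
  have h1 : DifferentiableAt ℝ (fun β => ∫ t, t ^ (1 - β) ∂m) α :=
    DifferentiableAt.comp α (g := fun p => ∫ t, t ^ p ∂m) (f := fun β => 1 - β)
      (hm.differentiableAt_integral_rpow ⟨by linarith [hα.2], by linarith [hα.1]⟩)
      (by fun_prop)
  have h2 : DifferentiableAt ℝ
      (fun β => (∫ t, t ^ (1 - β) ∂m - m.real univ) / (β - 1)) α :=
    (h1.sub_const _).div (by fun_prop) (sub_ne_zero.2 hα.2.ne)
  refine h2.congr_of_eventuallyEq ?_
  filter_upwards [Ioo_mem_nhds hα.1 hα.2] with β hβ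
  rw [hm.extIntegral_renyiIntegrand ⟨hβ.1.le, hβ.2⟩, EReal.toReal_coe]

/-- The symmetry `(1 - α) S_α = α S_{1 - α}` of the Rényi entropies. -/
lemma toReal_extIntegral_one_sub (hm : IsInversionSymmetric m) {α : ℝ}
    (hα : α ∈ Ioo (0 : ℝ) 1) :
    (extIntegral m (renyiIntegrand α)).toReal / α =
      (extIntegral m (renyiIntegrand (1 - α))).toReal / (1 - α) := by
  have h1 : 1 - α ∈ Ico (0 : ℝ) 1 := ⟨by linarith [hα.2], by linarith [hα.1]⟩
  rw [hm.extIntegral_renyiIntegrand ⟨hα.1.le, hα.2⟩, hm.extIntegral_renyiIntegrand h1,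
    EReal.toReal_coe, EReal.toReal_coe, hm.integral_rpow_one_sub (1 - α)]
  have h2 : α - 1 ≠ 0 := sub_ne_zero.2 hα.2.ne
  have h3 : 1 - α ≠ 0 := sub_ne_zero.2 hα.2.ne'
  have h4 := hα.1.ne'
  rw [show 1 - α - 1 = -α by ring, ← neg_sub 1 α]
  field_simp

/-- Since `S_0 = 0`, the difference quotient at `0` is `S_β / β = S_{1-β} / (1 - β)`. By continuity
at `1` it tends to `S_1`, which is therefore the derivative. -/
lemma differentiableWithinAt_extIntegral_zero (hm : IsInversionSymmetric m)
    (hfin : extIntegral m (renyiIntegrand 1) < ⊤) :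
    DifferentiableWithinAt ℝ (fun β => (extIntegral m (renyiIntegrand β)).toReal) (Ici 0) 0 := by
  set r : ℝ → ℝ := fun β => (extIntegral m (renyiIntegrand β)).toReal with hr
  have hr0 : r 0 = 0 := by simp [hr, hm.extIntegral_zero]
  have h1 : Tendsto r (𝓝[Icc 0 1] 1) (𝓝 (r 1)) :=
    (EReal.tendsto_toReal hfin.ne (EReal.bot_lt_zero.trans_le
      (hm.extIntegral_nonneg ⟨zero_le_one, le_rfl⟩)).ne').comp
      (hm.continuousOn_extIntegral 1 ⟨zero_le_one, le_rfl⟩)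
  have hmem : ∀ᶠ β : ℝ in 𝓝[>] 0, β ∈ Ioo (0 : ℝ) 1 := Ioo_mem_nhdsGT zero_lt_one
  have hsub : Tendsto (fun β : ℝ => 1 - β) (𝓝[>] 0) (𝓝 1) := by
    have : Tendsto (fun β : ℝ => 1 - β) (𝓝 0) (𝓝 (1 - 0)) := tendsto_const_nhds.sub tendsto_id
    rw [sub_zero] at this
    exact this.mono_left nhdsWithin_le_nhds
  have h2 : Tendsto (fun β : ℝ => r (1 - β)) (𝓝[>] 0) (𝓝 (r 1)) :=
    h1.comp (tendsto_nhdsWithin_iff.2 ⟨hsub, hmem.mono fun β hβ =>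
      ⟨by linarith [hβ.2], by linarith [hβ.1]⟩⟩)
  have h3 : Tendsto (fun β : ℝ => r (1 - β) / (1 - β)) (𝓝[>] 0) (𝓝 (r 1)) := by
    have h := h2.div hsub one_ne_zero
    rwa [div_one] at h
  have h4 : HasDerivWithinAt r (r 1) (Ici 0) 0 := by
    rw [hasDerivWithinAt_iff_tendsto_slope, Ici_sdiff_left]
    refine h3.congr' ?_
    filter_upwards [hmem] with β hβ
    rw [slope_def_field, hr0, sub_zero, sub_zero]
    exact (hm.toReal_extIntegral_one_sub hβ).symm
  exact h4.differentiableWithinAt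

end IsInversionSymmetric

end Analysis

/-! ### Inversion symmetry of the spectral measure of `δ` -/

section Symmetry

open MeasureTheory Filter Topology Set Polynomial
open scoped ComplexInnerProductSpace

/-- Finite measures on the unit interval are determined by their moments. -/
lemma measure_ext_of_integral_polynomial {μ ν : Measure ℝ} [IsFiniteMeasure μ] [IsFiniteMeasure ν]
    (hμ : ∀ᵐ u ∂μ, u ∈ Icc (0 : ℝ) 1) (hν : ∀ᵐ u ∂ν, u ∈ Icc (0 : ℝ) 1)
    (h : ∀ p : ℝ[X], ∫ u, p.eval u ∂μ = ∫ u, p.eval u ∂ν) : μ = ν := by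
  have hint : ∀ (m : Measure ℝ) [IsFiniteMeasure m], (∀ᵐ u ∂m, u ∈ Icc (0 : ℝ) 1) →
      ∀ k : ℝ → ℝ, Continuous k → Integrable k m := by
    intro m _ hm k hk
    obtain ⟨C, hC⟩ := (isCompact_Icc (a := (0 : ℝ)) (b := 1)).exists_bound_of_continuousOn
      hk.continuousOn
    exact Integrable.of_bound hk.aestronglyMeasurable C (hm.mono hC)
  have happ : ∀ (m : Measure ℝ) [IsFiniteMeasure m], (∀ᵐ u ∂m, u ∈ Icc (0 : ℝ) 1) →
      ∀ (k : ℝ → ℝ) (p : ℝ[X]) (ε : ℝ), Continuous k →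
        (∀ u ∈ Icc (0 : ℝ) 1, |p.eval u - k u| < ε) →
        |∫ u, p.eval u ∂m - ∫ u, k u ∂m| ≤ ε * m.real univ := by
    intro m _ hm k p ε hk hp
    rw [← integral_sub (hint m hm _ p.continuous) (hint m hm k hk)]
    rw [← Real.norm_eq_abs]
    exact norm_integral_le_of_norm_le_const (hm.mono fun u hu => (hp u hu).le)
  refine ext_of_forall_integral_eq_of_IsFiniteMeasure fun k => ?_
  refine eq_of_abs_sub_le_all fun ε hε => ?_
  set M := μ.real univ + ν.real univ + 1 with hM
  have hM0 : 0 < M := by positivity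
  obtain ⟨p, hp⟩ := exists_polynomial_near_of_continuousOn 0 1 k k.continuous.continuousOn (ε / M)
    (by positivity)
  have h1 := happ μ hμ k p _ k.continuous hp
  have h2 := happ ν hν k p _ k.continuous hp
  rw [h p] at h1
  have h3 : ε / M * μ.real univ + ε / M * ν.real univ ≤ ε := by
    rw [← mul_add, div_mul_eq_mul_div, div_le_iff₀ hM0]
    exact mul_le_mul_of_nonneg_left (by linarith) hε.le
  rw [abs_le] at h1 h2 ⊢
  constructor <;> linarith [h1.1, h1.2, h2.1, h2.2]

variable {H : Type*} [NormedAddCommGroup H] [InnerProductSpace ℂ H] [CompleteSpace H]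

namespace StandardSubspace

variable (L : StandardSubspace H)

lemma spectrum_resolvent_subset : spectrum ℝ L.resolvent ⊆ Icc 0 1 := by
  intro u hu
  constructor
  · have h : (0 : H →L[ℂ] H) ≤ L.resolvent := by
      rw [ContinuousLinearMap.nonneg_iff_isPositive, ContinuousLinearMap.isPositive_def']
      exact ⟨L.isSelfAdjoint_resolvent, fun x => L.re_inner_resolvent_nonneg x⟩
    exact spectrum_nonneg_of_nonneg h hu
  · refine (le_abs_self u).trans ((spectrum.norm_le_norm_mul_of_mem hu).trans ?_)
    refine mul_le_one₀ L.norm_resolvent_le (norm_nonneg _) ?_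
    exact ContinuousLinearMap.norm_id_le

lemma mem_graph_modularOperator_iff_resolvent (x z : H) :
    (x, z) ∈ L.modularOperator.graph ↔ L.resolvent (x + z) = x := by
  constructor
  · intro h
    apply L.resolvent_eq_of_mem_graph
    rwa [add_sub_cancel_left]
  · intro h
    have := L.resolvent_mem_graph (x + z)
    rwa [h, add_sub_cancel_left] at this

theorem isResolutionOf_modularResolution :
    L.modularResolution.IsResolutionOf L.modularOperator :=
  Classical.epsilon_spec (p := fun e : ResolutionOfIdentity H => e.IsResolutionOf L.modularOperator)
    ⟨_, isResolutionOf_resolventResolution L.isSelfAdjoint_resolvent L.spectrum_resolvent_subset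
      (fun _ => L.resolvent_injective) L.mem_graph_modularOperator_iff_resolvent⟩

/-- The spectral measure of the modular operator in terms of its resolvent. -/
lemma spectralMeasure_eq (x : H) :
    L.spectralMeasure x = resolventMeasure L.isSelfAdjoint_resolvent x :=
  spectralMeasure_eq_resolventMeasure L.isSelfAdjoint_resolvent L.spectrum_resolvent_subset
    (fun _ => L.resolvent_injective)
    (L.isResolutionOf_modularResolution.proj_eq_resolventProj L.isSelfAdjoint_resolvent
      L.spectrum_resolvent_subset (fun _ => L.resolvent_injective)
      L.mem_graph_modularOperator_iff_resolvent) x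

/-- The mass at `u = 1` belongs to the kernel of `1 - B`, which is trivial. -/
lemma ae_mem_Ioo_resolvent (x : H) :
    ∀ᵐ u ∂(boundedSpectralMeasure L.isSelfAdjoint_resolvent x), u ∈ Ioo (0 : ℝ) 1 := by
  have h := boundedSpectralMeasure_zeros L.isSelfAdjoint_resolvent x (h := fun u => 1 - u)
    (by fun_prop)
  have hsub : cfc (fun u : ℝ => 1 - u) L.resolvent = 1 - L.resolvent := by
    rw [cfc_sub (fun _ => (1 : ℝ)) (fun u => u) L.resolvent, cfc_const_one ℝ L.resolvent
      L.isSelfAdjoint_resolvent, cfc_id' ℝ L.resolvent L.isSelfAdjoint_resolvent]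
  rw [hsub, L.one_sub_resolvent_injective (apply_kerProj _ x), norm_zero, zero_pow two_ne_zero,
    measureReal_eq_zero_iff] at h
  have h' : ∀ᵐ u ∂(boundedSpectralMeasure L.isSelfAdjoint_resolvent x), 1 - u ≠ 0 := by
    rw [ae_iff]
    simpa using h
  filter_upwards [h', ae_pos_boundedSpectralMeasure L.isSelfAdjoint_resolvent
    L.spectrum_resolvent_subset (fun _ => L.resolvent_injective) x] with u h1 h2
  exact ⟨h2.1, lt_of_le_of_ne h2.2 fun h3 => h1 (by rw [h3, sub_self])⟩

lemma integral_one_sub_mul_polynomial {f : H} (hf : f ∈ L.toClosedSubmodule) (p : ℝ[X]) :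
    ∫ u, (1 - u) * p.eval u ∂(boundedSpectralMeasure L.isSelfAdjoint_resolvent f) =
      ∫ u, (1 - u) * p.eval (1 - u) ∂(boundedSpectralMeasure L.isSelfAdjoint_resolvent f) := by
  have key : ∀ q : ℝ[X], ∫ u, q.eval u ∂(boundedSpectralMeasure L.isSelfAdjoint_resolvent f) =
      (⟪f, aeval L.resolvent q f⟫).re := fun q => by
    rw [integral_boundedSpectralMeasure _ _ q.continuous,
      cfc_polynomial q L.resolvent L.isSelfAdjoint_resolvent]
  have h1 := key ((1 - X) * p)
  have h2 := key ((1 - X) * p.comp (1 - X))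
  simp only [eval_mul, eval_sub, eval_one, eval_X, eval_comp, map_mul, map_sub, map_one, aeval_X,
    aeval_comp] at h1 h2
  rw [h1, h2]
  exact L.re_inner_aeval_resolvent p hf

/-- The measure `(1 - u) d(f, E_u f)` with the spectral projections `E_u` of the resolvent. -/
noncomputable def weightedMeasure (f : H) : Measure ℝ :=
  (boundedSpectralMeasure L.isSelfAdjoint_resolvent f).withDensity fun u => ENNReal.ofReal (1 - u)

instance (f : H) : IsFiniteMeasure (L.weightedMeasure f) :=
  isFiniteMeasure_withDensity_ofReal
    (integrable_boundedSpectralMeasure L.isSelfAdjoint_resolvent f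
      (g := fun u => 1 - u) (by fun_prop)).hasFiniteIntegral

/-- Both measures live on `[0, 1]` and have equal moments by the operator symmetry, so Weierstrass
approximation identifies them. -/
lemma map_weightedMeasure {f : H} (hf : f ∈ L.toClosedSubmodule) :
    (L.weightedMeasure f).map (fun u => 1 - u) = L.weightedMeasure f := by
  have hae : ∀ᵐ u ∂(L.weightedMeasure f), u ∈ Icc (0 : ℝ) 1 :=
    (withDensity_absolutelyContinuous _ _).ae_le
      ((L.ae_mem_Ioo_resolvent f).mono fun u hu => Ioo_subset_Icc_self hu)
  have hint : ∀ k : ℝ → ℝ, ∫ u, k u ∂(L.weightedMeasure f) =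
      ∫ u, (1 - u) * k u ∂(boundedSpectralMeasure L.isSelfAdjoint_resolvent f) := by
    intro k
    rw [weightedMeasure, integral_withDensity_eq_integral_toReal_smul (by fun_prop) (by simp)]
    refine integral_congr_ae ((L.ae_mem_Ioo_resolvent f).mono fun u hu => ?_)
    simp only
    rw [ENNReal.toReal_ofReal (by linarith [hu.2]), smul_eq_mul]
  refine measure_ext_of_integral_polynomial ?_ hae fun p => ?_
  · refine (ae_map_iff (p := fun u => u ∈ Icc (0 : ℝ) 1) (by fun_prop) measurableSet_Icc).2 ?_
    exact hae.mono fun u hu => ⟨by linarith [hu.2], by linarith [hu.1]⟩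
  · rw [integral_map (by fun_prop) p.continuous.aestronglyMeasurable, hint, hint]
    exact (L.integral_one_sub_mul_polynomial hf p).symm

/-- On vectors of `L`, the spectral measure of `δ` is symmetric under `δ ↦ δ⁻¹`. -/
theorem isInversionSymmetric_spectralMeasure {f : H} (hf : f ∈ L.toClosedSubmodule) :
    IsInversionSymmetric (L.spectralMeasure f) := by
  have hae := L.ae_mem_Ioo_resolvent f
  rw [spectralMeasure_eq]
  constructor
  · rw [resolventMeasure, ae_map_iff (by fun_prop) measurableSet_Ioi]
    exact hae.mono fun u hu => sub_pos.2 ((one_lt_inv₀ hu.1).2 hu.2)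
  · intro h hh
    -- With `t = u⁻¹ - 1`, the weight `1 - u` times `u⁻¹` is `t`. The reflection `u ↦ 1 - u`
    -- replaces `t` by `1 / t` and `u⁻¹` by `(1 - u)⁻¹`, which cancels the weight.
    have hk : Measurable fun u : ℝ => ENNReal.ofReal u⁻¹ * h (u⁻¹ - 1) := by fun_prop
    have hw : ∀ k : ℝ → ENNReal, Measurable k → ∫⁻ u, k u ∂(L.weightedMeasure f) =
        ∫⁻ u, ENNReal.ofReal (1 - u) * k u
          ∂(boundedSpectralMeasure L.isSelfAdjoint_resolvent f) := fun k hk => by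
      rw [weightedMeasure, lintegral_withDensity_eq_lintegral_mul _ (by fun_prop) hk]
      rfl
    have h1 := hw _ hk
    rw [← L.map_weightedMeasure hf, lintegral_map hk (by fun_prop), hw _ (by fun_prop)] at h1
    rw [resolventMeasure, lintegral_map (by fun_prop) (by fun_prop),
      lintegral_map (by fun_prop) (by fun_prop)]
    refine Eq.trans ?_ (h1.symm.trans ?_)
    · refine lintegral_congr_ae (hae.mono fun u hu => ?_)
      have := hu.1.ne'
      beta_reduce
      rw [← mul_assoc, ← ENNReal.ofReal_mul (by linarith [hu.2])]
      congr 2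
      field_simp
    · refine lintegral_congr_ae (hae.mono fun u hu => ?_)
      beta_reduce
      have h2 : 0 < 1 - u := sub_pos.2 hu.2
      have h3 := hu.1.ne'
      rw [← mul_assoc, ← ENNReal.ofReal_mul h2.le, mul_inv_cancel₀ h2.ne', ENNReal.ofReal_one,
        one_mul]
      congr 1
      have h4 : u⁻¹ - 1 = (1 - u) / u := by field_simp
      rw [h4, inv_div]
      field_simp
      ring

end StandardSubspace

end Symmetry

/-! ### Entropies of the vectors of `L` -/

theorem proposition3 {H : Type*} [NormedAddCommGroup H] [InnerProductSpace ℂ H] [CompleteSpace H]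
    (L : StandardSubspace H) :
    -- the modular operator has a spectral resolution
    L.modularResolution.IsResolutionOf L.modularOperator ∧
    ∀ f ∈ L.toClosedSubmodule,
      -- the entropies are well defined: the measure `d(f, e_t f)` lives on `(0, ∞)`,
      L.spectralMeasure f (Set.Iic 0) = 0 ∧
      -- for `0 ≤ α < 1` the integral converges,
      (∀ α ∈ Set.Ico (0 : ℝ) 1,
        MeasureTheory.IntegrableOn (fun t : ℝ => (t ^ (1 - α) - 1) / (α - 1)) (Set.Ioi 0)
          (L.spectralMeasure f) ∧
        L.renyiEntropy α f =
          ((∫ t in Set.Ioi (0 : ℝ), (t ^ (1 - α) - 1) / (α - 1) ∂(L.spectralMeasure f) : ℝ) :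
            EReal)) ∧
      -- and for `α = 1` the negative part of `- ln t` has a finite integral
      (∫⁻ t in Set.Ioi (0 : ℝ), ENNReal.ofReal (Real.log t) ∂(L.spectralMeasure f)) < ⊤ ∧
      -- continuity on `[0, 1]`, differentiability on `(0, 1)`
      ContinuousOn (fun α : ℝ => L.renyiEntropy α f) (Set.Icc 0 1) ∧
      (∀ α ∈ Set.Ioo (0 : ℝ) 1,
        DifferentiableAt ℝ (fun β : ℝ => (L.renyiEntropy β f).toReal) α) ∧
      -- and (one-sided) differentiability at `0` if the entropy of `f` is finite
      (L.entropy f < ⊤ →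
        DifferentiableWithinAt ℝ (fun β : ℝ => (L.renyiEntropy β f).toReal) (Set.Ici 0) 0) ∧
      -- value at `0`, monotonicity, non-negativity
      L.renyiEntropy 0 f = 0 ∧
      MonotoneOn (fun α : ℝ => L.renyiEntropy α f) (Set.Icc 0 1) ∧
      (∀ α ∈ Set.Icc (0 : ℝ) 1, 0 ≤ L.renyiEntropy α f) ∧
      -- the limit `α → 1⁻`, and the upper bound
      Filter.Tendsto (fun α : ℝ => L.renyiEntropy α f) (nhdsWithin 1 (Set.Iio 1))
        (nhds (L.entropy f)) ∧
      (∀ α ∈ Set.Icc (0 : ℝ) 1, L.renyiEntropy α f ≤ L.entropy f) := by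
  refine ⟨L.isResolutionOf_modularResolution, fun f hf => ?_⟩
  have hm := L.isInversionSymmetric_spectralMeasure hf
  have hfin : MeasureTheory.IsFiniteMeasure (L.spectralMeasure f) := by
    unfold StandardSubspace.spectralMeasure
    infer_instance
  have hS : ∀ α, L.renyiEntropy α f =
      extIntegral (L.spectralMeasure f) (StandardSubspace.renyiIntegrand α) := fun α => by
    rw [StandardSubspace.renyiEntropy, hm.restrict_Ioi]
  have hE : L.entropy f = L.renyiEntropy 1 f := by
    rw [StandardSubspace.entropy, StandardSubspace.renyiEntropy]
    congr 1
    exact funext fun t => (renyiIntegrand_one t).symm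
  have h1 : (1 : ℝ) ∈ Set.Icc (0 : ℝ) 1 := ⟨zero_le_one, le_rfl⟩
  rw [hE]
  simp only [hS, hm.restrict_Ioi, MeasureTheory.IntegrableOn]
  refine ⟨?_, fun α hα => ?_, hm.lintegral_log_lt_top, hm.continuousOn_extIntegral,
    fun α hα => hm.differentiableAt_extIntegral hα, hm.differentiableWithinAt_extIntegral_zero,
    hm.extIntegral_zero, hm.monotoneOn_extIntegral, fun α hα => hm.extIntegral_nonneg hα, ?_,
    fun α hα => hm.monotoneOn_extIntegral hα h1 hα.2⟩
  · have := hm.ae_pos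
    rw [MeasureTheory.ae_iff] at this
    simpa [Set.Iic] using this
  · rw [← funext (renyiIntegrand_of_ne hα.2.ne)]
    exact ⟨hm.integrable_renyiIntegrand hα,
      extIntegral_of_integrable (hm.integrable_renyiIntegrand hα)⟩
  · have h := hm.continuousOn_extIntegral 1 h1
    rw [← nhdsWithin_Ioo_eq_nhdsLT (zero_lt_one' ℝ)]
    exact h.mono_left (nhdsWithin_mono _ Set.Ioo_subset_Icc_self)
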